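/- For $n\ge 0$ let $K_n=\mathbb{C}(x_1,\dots,x_n,y_1,\dots,y_n)$ be the Poisson field with bracket $\{f,g\}=\sum_i\left(\frac{\partial f}{\partial x_i}\frac{\partial g}{\partial y_i}-\frac{\partial f}{\partial y_i}\frac{\partial g}{\partial x_i}\right)$, the field of rational functions on $(\mathbb{C}^2)^n$ with coordinates $(x_i,y_i)$; write $x=x_1$, $y=y_1$ for $n=1$. Let $\Gamma$ be a finite subgroup of $SL_2(\mathbb{C})$ of order $m$, acting naturally on $\mathbb{C}^2$, and let $G=\Gamma\wr S_n=\Gamma^n\rtimes S_n$ act naturally on $(\mathbb{C}^2)^n$. These groups act on $K_1$ and $K_n$ by Poisson automorphisms, $(gf)(p)=f(g^{-1}p)$, so that $K_1^\Gamma$ and $K_n^G$ are Poisson fields. Put $t=y/x$. Call $(u,v)$, with $u,v\in K_1^\Gamma$, a canonical pair if there is an isomorphism of Poisson fields $K_1^\Gamma\to K_1$ over $\mathbb{C}$ with $u\mapsto x$, $v\mapsto y$. Call $(u,v)$ an explicit pair if it has one of the following two forms. (E1) $u=\dfrac{\ell_1}{m\,\ell_2^{\,m-1}}$ and $v=\ell_2^{\,m}$,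 where $\ell_1,\ell_2\in\mathbb{C}x+\mathbb{C}y$ satisfy $\{\ell_1,\ell_2\}=1$ and each of them is mapped by every element of $\Gamma$ to a scalar multiple of itself. (E2) $-1\in\Gamma$, $v$ is a generator of $\mathbb{C}(t)^\Gamma$, that is $\mathbb{C}(v)=\mathbb{C}(t)\cap K_1^\Gamma$, and $u=\dfrac{x^2}{2\,dv/dt}$, where $dv/dt=x\,\partial v/\partial y$. Then the following hold. (1) For every $a\in\mathbb{C}$ such that $g_{22}\ne a\,g_{12}$ for all $g=(g_{ij})\in\Gamma$ (this excludes only finitely many $a$), the product $v=\prod_{s\in\Gamma\cdot t}(s-a)$ over the $\Gamma$-orbit of $t$ generates $\mathbb{C}(t)^\Gamma$. (2) Explicit pairs exist for $\Gamma$, and every explicit pair is a canonical pair. (3) Let $(u,v)$ be any canonical pair, let $u_i,v_i\in K_n$ be its copies in the $i$-th factor (obtained by $x\mapsto x_i$, $y\mapsto y_i$), let $e_1,\dots,e_n$ be the elementary symmetric polynomials in $z_1,\dots,z_n$, and let $M$ be the $n\times n$ matrix over $K_n$ with entries $M_{ij}=\frac{\partial e_j}{\partial z_i}(v_1,\dots,v_n)$.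 Then $\det M\ne 0$, and with $$V_i=e_i(v_1,\dots,v_n),\qquad U_i=\sum_{j=1}^n (M^{-1})_{ij}\,u_j\qquad(i=1,\dots,n)$$ the elements $U_i,V_i$ lie in $K_n^G$ and there is an isomorphism of Poisson fields $K_n^G\cong K_n$ over $\mathbb{C}$ with $U_i\mapsto x_i$ and $V_i\mapsto y_i$ for all $i$. In particular $K_n^G\cong K_n$ as Poisson fields, by the explicit isomorphism that (3) gives for an explicit pair $(u,v)$. -/

import Mathlib

noncomputable section

namespace PoissonNoether

/-! ### Poisson algebras -/

/-- A Poisson bracket on a commutative `R`-algebra `A`. -/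
class PoissonAlgebra (R A : Type*) [CommRing R] [CommRing A] [Algebra R A] where
  pb : A → A → A
  pb_add : ∀ f g h, pb f (g + h) = pb f g + pb f h
  pb_smul : ∀ (c : R) f g, pb f (c • g) = c • pb f g
  pb_self : ∀ f, pb f f = 0
  pb_skew : ∀ f g, pb f g = -pb g f
  pb_mul : ∀ f g h, pb f (g * h) = g * pb f h + h * pb f g
  pb_jacobi : ∀ f g h, pb f (pb g h) + pb g (pb h f) + pb h (pb f g) = 0

/-- Isomorphisms of Poisson algebras. -/
structure PoissonEquiv (R A B : Type*) [CommRing R] [CommRing A] [CommRing B] [Algebra R A]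
    [Algebra R B] [PoissonAlgebra R A] [PoissonAlgebra R B] extends A ≃ₐ[R] B where
  map_pb : ∀ f g : A, toAlgEquiv (PoissonAlgebra.pb R f g) =
    PoissonAlgebra.pb R (toAlgEquiv f) (toAlgEquiv g)

/-! ### Derivations of fraction fields -/

section FracDeriv

theorem fracDeriv_aux {A : Type*} [CommRing A] [Algebra ℂ A] (D : Derivation ℂ A A) {F : Type*} [Field F] [Algebra A F]
    [IsFractionRing A F] (a b c d : A) (hb : b ≠ 0) (hd : d ≠ 0)
    (h : algebraMap A F a / algebraMap A F b = algebraMap A F c / algebraMap A F d) :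
    (algebraMap A F (D a) * algebraMap A F b - algebraMap A F a * algebraMap A F (D b)) /
        algebraMap A F b ^ 2 =
      (algebraMap A F (D c) * algebraMap A F d - algebraMap A F c * algebraMap A F (D d)) /
        algebraMap A F d ^ 2 := by
  have hinj : Function.Injective (algebraMap A F) := IsFractionRing.injective A F
  have hb' : algebraMap A F b ≠ 0 := by simpa using hinj.ne hb
  have hd' : algebraMap A F d ≠ 0 := by simpa using hinj.ne hd
  rw [div_eq_div_iff hb' hd'] at h
  have h1 : a * d = c * b := hinj (by simpa using h)
  have h2 := congrArg (algebraMap A F) (congrArg D h1)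
  simp only [Derivation.leibniz, smul_eq_mul, map_add, map_mul] at h2
  rw [div_eq_div_iff (pow_ne_zero 2 hb') (pow_ne_zero 2 hd')]
  linear_combination (algebraMap A F b * algebraMap A F d) * h2 -
    (algebraMap A F b * algebraMap A F (D d) + algebraMap A F d * algebraMap A F (D b)) * h

variable {A : Type*} [CommRing A] [IsDomain A] [Algebra ℂ A]

/-- The extension of a derivation to the field of fractions by the quotient rule
`D (a / b) = (D a * b - a * D b) / b ^ 2`. -/
def fracDerivFun (D : Derivation ℂ A A) (f : FractionRing A) : FractionRing A :=
  let a := (IsLocalization.sec (nonZeroDivisors A) f).1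
  let b := (IsLocalization.sec (nonZeroDivisors A) f).2.1
  (algebraMap A (FractionRing A) (D a) * algebraMap A _ b -
    algebraMap A _ a * algebraMap A _ (D b)) / algebraMap A _ b ^ 2

theorem fracDerivFun_div (D : Derivation ℂ A A) (a b : A) (hb : b ≠ 0) :
    fracDerivFun D (algebraMap A _ a / algebraMap A _ b) =
      (algebraMap A (FractionRing A) (D a) * algebraMap A _ b -
        algebraMap A _ a * algebraMap A _ (D b)) / algebraMap A _ b ^ 2 := by
  unfold fracDerivFun
  apply fracDeriv_aux D _ _ _ _ (nonZeroDivisors.coe_ne_zero _) hb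
  rw [← IsFractionRing.mk'_eq_div, IsLocalization.mk'_sec]

/-- The derivation of the field of fractions extending a given derivation. -/
def fracDeriv (D : Derivation ℂ A A) : Derivation ℂ (FractionRing A) (FractionRing A) :=
  Derivation.mk'
    { toFun := fracDerivFun D
      map_add' := by
        intro f g
        obtain ⟨a, b, hb, rfl⟩ := IsFractionRing.div_surjective A f
        obtain ⟨c, d, hd, rfl⟩ := IsFractionRing.div_surjective A g
        have hb := nonZeroDivisors.ne_zero hb
        have hd := nonZeroDivisors.ne_zero hd
        have hb' : algebraMap A (FractionRing A) b ≠ 0 := by simpa using hb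
        have hd' : algebraMap A (FractionRing A) d ≠ 0 := by simpa using hd
        rw [div_add_div _ _ hb' hd', ← map_mul, ← map_mul, ← map_mul, ← map_add,
          fracDerivFun_div D _ _ (mul_ne_zero hb hd), fracDerivFun_div D _ _ hb,
          fracDerivFun_div D _ _ hd]
        simp only [Derivation.leibniz, smul_eq_mul, map_add, map_mul]
        field_simp
        ring
      map_smul' := by
        intro r f
        obtain ⟨a, b, hb, rfl⟩ := IsFractionRing.div_surjective A f
        have hb := nonZeroDivisors.ne_zero hb
        have e : r • (algebraMap A (FractionRing A) a / algebraMap A _ b) =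
            algebraMap A _ (r • a) / algebraMap A _ b := by
          rw [Algebra.smul_def, Algebra.smul_def, map_mul,
            ← IsScalarTower.algebraMap_apply ℂ A (FractionRing A), mul_div_assoc]
        rw [e, fracDerivFun_div D _ _ hb, fracDerivFun_div D _ _ hb, RingHom.id_apply,
          Derivation.map_smul]
        simp only [Algebra.smul_def, map_mul,
          ← IsScalarTower.algebraMap_apply ℂ A (FractionRing A)]
        ring }
    (by
      intro f g
      obtain ⟨a, b, hb, rfl⟩ := IsFractionRing.div_surjective A f
      obtain ⟨c, d, hd, rfl⟩ := IsFractionRing.div_surjective A g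
      have hb := nonZeroDivisors.ne_zero hb
      have hd := nonZeroDivisors.ne_zero hd
      have hb' : algebraMap A (FractionRing A) b ≠ 0 := by simpa using hb
      have hd' : algebraMap A (FractionRing A) d ≠ 0 := by simpa using hd
      change fracDerivFun D _ = _ • fracDerivFun D _ + _ • fracDerivFun D _
      rw [div_mul_div_comm, ← map_mul, ← map_mul,
        fracDerivFun_div D _ _ (mul_ne_zero hb hd), fracDerivFun_div D _ _ hb,
        fracDerivFun_div D _ _ hd]
      simp only [Derivation.leibniz, smul_eq_mul, map_add, map_mul]
      field_simp
      ring)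

theorem fracDeriv_algebraMap (D : Derivation ℂ A A) (a : A) :
    fracDeriv D (algebraMap A _ a) = algebraMap A _ (D a) := by
  have h := fracDerivFun_div D a 1 one_ne_zero
  simp only [map_one, div_one, Derivation.map_one_eq_zero, map_zero, mul_zero, sub_zero,
    mul_one, one_pow] at h
  exact h

theorem derivation_ext_frac {D E : Derivation ℂ (FractionRing A) (FractionRing A)}
    (h : ∀ a : A, D (algebraMap A _ a) = E (algebraMap A _ a)) : D = E := by
  ext f
  obtain ⟨a, b, hb, rfl⟩ := IsFractionRing.div_surjective A f
  have hb := nonZeroDivisors.ne_zero hb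
  have hb' : algebraMap A (FractionRing A) b ≠ 0 := by simpa using hb
  have key : ∀ D : Derivation ℂ (FractionRing A) (FractionRing A),
      D (algebraMap A _ a) = algebraMap A _ a / algebraMap A _ b * D (algebraMap A _ b) +
        algebraMap A _ b * D (algebraMap A _ a / algebraMap A _ b) := by
    intro D
    conv_lhs => rw [← div_mul_cancel₀ (algebraMap A (FractionRing A) a) hb']
    rw [Derivation.leibniz, smul_eq_mul, smul_eq_mul]
  have h1 := key D
  have h2 := key E
  rw [h a, h b, h2] at h1
  exact (mul_left_cancel₀ hb' (add_left_cancel h1)).symm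

end FracDeriv

/-! ### The Poisson-Weyl algebra and its field of fractions -/

/-- The algebra of polynomial functions on `(ℂ²)ⁿ`; the variable `(i, 0)` is `xᵢ` and the
variable `(i, 1)` is `yᵢ`. -/
abbrev P (n : ℕ) : Type := MvPolynomial (Fin n × Fin 2) ℂ

/-- The field of fractions of the Poisson-Weyl algebra. -/
abbrev K (n : ℕ) : Type := FractionRing (P n)

/-- The coordinate functions in `K n`. -/
def coord {n : ℕ} (p : Fin n × Fin 2) : K n := algebraMap (P n) (K n) (MvPolynomial.X p)

def x {n : ℕ} (i : Fin n) : K n := coord (i, 0)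

def y {n : ℕ} (i : Fin n) : K n := coord (i, 1)

/-- The partial derivative of a rational function with respect to a coordinate. -/
def partialD {n : ℕ} (p : Fin n × Fin 2) : Derivation ℂ (K n) (K n) :=
  fracDeriv (MvPolynomial.pderiv p)

/-- `{f, g} = ∑ᵢ (∂f/∂xᵢ ∂g/∂yᵢ - ∂f/∂yᵢ ∂g/∂xᵢ)`, so that `{xᵢ, yⱼ} = δᵢⱼ`. -/
def bracket {n : ℕ} (f g : K n) : K n :=
  ∑ i : Fin n, (partialD (i, 0) f * partialD (i, 1) g - partialD (i, 1) f * partialD (i, 0) g)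

theorem partialD_coord {n : ℕ} (p q : Fin n × Fin 2) :
    partialD p (coord q) = if q = p then 1 else 0 := by
  unfold partialD coord
  rw [fracDeriv_algebraMap, MvPolynomial.pderiv_X, Pi.single_apply]
  split_ifs <;> simp_all

theorem derivation_ext {n : ℕ} {D E : Derivation ℂ (K n) (K n)}
    (h : ∀ p, D (coord p) = E (coord p)) : D = E := by
  apply derivation_ext_frac
  intro a
  have : D.compAlgebraMap (P n) = E.compAlgebraMap (P n) :=
    MvPolynomial.derivation_ext fun p => h p
  exact DFunLike.congr_fun this a

theorem partialD_comm {n : ℕ} (p q : Fin n × Fin 2) (f : K n) :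
    partialD p (partialD q f) = partialD q (partialD p f) := by
  have : ⁅partialD p, partialD q⁆ = (0 : Derivation ℂ (K n) (K n)) := by
    apply derivation_ext
    intro r
    rw [Derivation.commutator_apply, partialD_coord, partialD_coord]
    split_ifs <;> simp
  have h := DFunLike.congr_fun this f
  rw [Derivation.commutator_apply] at h
  exact sub_eq_zero.mp h

/-- The Hamiltonian derivation `{f, ·}`. -/
def ham {n : ℕ} (f : K n) : Derivation ℂ (K n) (K n) :=
  ∑ i : Fin n, (partialD (i, 0) f • partialD (i, 1) - partialD (i, 1) f • partialD (i, 0))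

theorem ham_apply {n : ℕ} (f g : K n) : ham f g = bracket f g := by
  unfold ham bracket
  rw [← Derivation.coeFnAddMonoidHom_apply, map_sum, Finset.sum_apply]
  rfl

theorem bracket_skew {n : ℕ} (f g : K n) : bracket f g = -bracket g f := by
  unfold bracket
  rw [← Finset.sum_neg_distrib]
  exact Finset.sum_congr rfl fun i _ => by ring

theorem partialD_bracket {n : ℕ} (p : Fin n × Fin 2) (f g : K n) :
    partialD p (bracket f g) = bracket (partialD p f) g + bracket f (partialD p g) := by
  unfold bracket
  rw [map_sum, ← Finset.sum_add_distrib]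
  refine Finset.sum_congr rfl fun i _ => ?_
  simp only [map_sub, Derivation.leibniz, smul_eq_mul, partialD_comm p]
  ring

theorem bracket_coord_zero {n : ℕ} (f : K n) (i : Fin n) :
    bracket f (coord (i, 0)) = -partialD (i, 1) f := by
  simp [bracket, partialD_coord, Finset.sum_ite_eq]

theorem bracket_coord_one {n : ℕ} (f : K n) (i : Fin n) :
    bracket f (coord (i, 1)) = partialD (i, 0) f := by
  simp [bracket, partialD_coord, Finset.sum_ite_eq]

theorem ham_bracket {n : ℕ} (f g : K n) : ⁅ham f, ham g⁆ = ham (bracket f g) := by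
  apply derivation_ext
  rintro ⟨i, a⟩
  rw [Derivation.commutator_apply]
  simp only [ham_apply]
  have hn : ∀ u v : K n, bracket u (-v) = -bracket u v := fun u v => by
    rw [← ham_apply, map_neg, ham_apply]
  fin_cases a
  · simp only [Fin.zero_eta, bracket_coord_zero, hn, partialD_bracket]
    rw [bracket_skew g]
    ring
  · simp only [Fin.mk_one, bracket_coord_one, partialD_bracket]
    rw [bracket_skew g]
    ring

/-- `K n` as a Poisson field. -/
instance instPoissonK (n : ℕ) : PoissonAlgebra ℂ (K n) where
  pb := bracket
  pb_add f g h := by simp only [← ham_apply, map_add]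
  pb_smul c f g := by simp only [← ham_apply, Derivation.map_smul]
  pb_self f := by
    unfold bracket
    exact Finset.sum_eq_zero fun i _ => by ring
  pb_skew := bracket_skew
  pb_mul f g h := by simp only [← ham_apply, Derivation.leibniz, smul_eq_mul]
  pb_jacobi f g h := by
    have h1 := DFunLike.congr_fun (ham_bracket f g) h
    rw [Derivation.commutator_apply] at h1
    simp only [ham_apply] at h1
    have hn : ∀ u v : K n, bracket u (-v) = -bracket u v := fun u v => by
      rw [← ham_apply, map_neg, ham_apply]
    rw [bracket_skew h f, hn, bracket_skew h (bracket f g), ← h1]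
    ring

/-! ### Invariants of groups of Poisson automorphisms -/

/-- Field automorphisms preserving the bracket. -/
def IsPoissonAut {n : ℕ} (s : K n ≃ₐ[ℂ] K n) : Prop :=
  ∀ f g, s (bracket f g) = bracket (s f) (s g)

/-- It suffices to compare brackets of coordinate functions. -/
theorem isPoissonAut_of_coord {n : ℕ} (s : K n ≃ₐ[ℂ] K n)
    (h : ∀ p q, s (bracket (coord p) (coord q)) = bracket (s (coord p)) (s (coord q))) :
    IsPoissonAut s := by
  let T : K n → Derivation ℂ (K n) (K n) := fun f =>
    Derivation.mk' (s.symm.toLinearMap ∘ₗ (ham (s f)).toLinearMap ∘ₗ s.toLinearMap) (by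
      intro a b
      change s.symm (ham (s f) (s (a * b))) =
        a • s.symm (ham (s f) (s b)) + b • s.symm (ham (s f) (s a))
      rw [map_mul, Derivation.leibniz]
      simp)
  have hT : ∀ f g, T f g = s.symm (bracket (s f) (s g)) := fun f g => by
    rw [← ham_apply]; rfl
  have step : ∀ f p, T f (coord p) = ham f (coord p) := by
    intro f p
    have e1 : T f (coord p) = -T (coord p) f := by
      rw [hT, hT, bracket_skew, map_neg]
    have e2 : T (coord p) = ham (coord p) := by
      apply derivation_ext
      intro q
      rw [hT, ← h, AlgEquiv.symm_apply_apply, ham_apply]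
    rw [e1, e2, ham_apply, ham_apply, ← bracket_skew]
  intro f g
  have e : T f = ham f := derivation_ext (step f)
  have e' := DFunLike.congr_fun e g
  rw [hT, ham_apply] at e'
  rw [← e', AlgEquiv.apply_symm_apply]

/-- The field of invariants of a group of Poisson automorphisms, with the restricted bracket. -/
@[reducible]
def invariantsPoisson {n : ℕ} (H : Subgroup (K n ≃ₐ[ℂ] K n)) (hH : ∀ s ∈ H, IsPoissonAut s) :
    PoissonAlgebra ℂ (IntermediateField.fixedField H) where
  pb f g := ⟨bracket f.1 g.1, by
    rw [IntermediateField.mem_fixedField_iff]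
    intro s hs
    rw [hH s hs, (IntermediateField.mem_fixedField_iff H _).mp f.2 s hs,
      (IntermediateField.mem_fixedField_iff H _).mp g.2 s hs]⟩
  pb_add f g h := Subtype.ext (PoissonAlgebra.pb_add (R := ℂ) f.1 g.1 h.1)
  pb_smul c f g := Subtype.ext (PoissonAlgebra.pb_smul (R := ℂ) c f.1 g.1)
  pb_self f := Subtype.ext (PoissonAlgebra.pb_self (R := ℂ) f.1)
  pb_skew f g := Subtype.ext (PoissonAlgebra.pb_skew (R := ℂ) f.1 g.1)
  pb_mul f g h := Subtype.ext (PoissonAlgebra.pb_mul (R := ℂ) f.1 g.1 h.1)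
  pb_jacobi f g h := Subtype.ext (PoissonAlgebra.pb_jacobi (R := ℂ) f.1 g.1 h.1)

/-! ### The wreath product and its action -/

abbrev SL2 : Type := Matrix.SpecialLinearGroup (Fin 2) ℂ

/-- The wreath product `Γ ≀ Sₙ = Γⁿ ⋊ Sₙ`, where `σ` maps `(γᵢ)ᵢ` to `(γ_{σ⁻¹ i})ᵢ`. -/
abbrev Wreath (Γ : Subgroup SL2) (n : ℕ) : Type :=
  (Fin n → Γ) ⋊[mulAutArrow (G := Equiv.Perm (Fin n)) (A := Fin n) (M := Γ)]
    Equiv.Perm (Fin n)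

/-- The matrix of the natural action on `(ℂ²)ⁿ`:
`(γ, σ)` sends `(pᵢ)ᵢ` to `(γᵢ p_{σ⁻¹ i})ᵢ`. -/
def wreathMat (Γ : Subgroup SL2) (n : ℕ) (g : Wreath Γ n) :
    Matrix (Fin n × Fin 2) (Fin n × Fin 2) ℂ :=
  Matrix.of fun p q =>
    if g.right⁻¹ p.1 = q.1 then ((g.left p.1 : SL2) : Matrix (Fin 2) (Fin 2) ℂ) p.2 q.2 else 0

/-- The natural representation of `Γ ≀ Sₙ` on `(ℂ²)ⁿ`. -/
def wreathMatrix (Γ : Subgroup SL2) (n : ℕ) :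
    Wreath Γ n →* Matrix (Fin n × Fin 2) (Fin n × Fin 2) ℂ where
  toFun := wreathMat Γ n
  map_one' := by
    ext ⟨i, a⟩ ⟨j, b⟩
    simp [wreathMat, Matrix.one_apply, Prod.ext_iff, ite_and]
  map_mul' g h := by
    ext ⟨i, a⟩ ⟨j, b⟩
    have hl : (g * h).left i = g.left i * h.left (g.right⁻¹ i) := rfl
    have hr : (g * h).right⁻¹ i = h.right⁻¹ (g.right⁻¹ i) := by
      rw [SemidirectProduct.mul_right, mul_inv_rev, Equiv.Perm.mul_apply]
    rw [Matrix.mul_apply, Fintype.sum_prod_type, Finset.sum_eq_single (g.right⁻¹ i)]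
    · simp only [wreathMat, Matrix.of_apply, hl, hr, if_true, Subgroup.coe_mul,
        Matrix.SpecialLinearGroup.coe_mul, Matrix.mul_apply]
      split_ifs <;> simp
    · intro k _ hk
      refine Finset.sum_eq_zero fun c _ => ?_
      rw [wreathMat, Matrix.of_apply, if_neg hk.symm, zero_mul]
    · simp

/-- The substitution of linear forms `z_p ↦ ∑_q A p q z_q`, i.e. `f ↦ f ∘ A`. -/
def linSubst {n : ℕ} (A : Matrix (Fin n × Fin 2) (Fin n × Fin 2) ℂ) : P n →ₐ[ℂ] P n :=
  MvPolynomial.aeval fun p => ∑ q, MvPolynomial.C (A p q) * MvPolynomial.X q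

/-- The action of `Γ ≀ Sₙ` on polynomial functions, `(g f)(p) = f (g⁻¹ p)`. -/
def wreathActP (Γ : Subgroup SL2) (n : ℕ) : Wreath Γ n →* (P n →ₐ[ℂ] P n) where
  toFun g := linSubst (wreathMatrix Γ n g⁻¹)
  map_one' := by
    apply MvPolynomial.algHom_ext
    intro p
    simp [linSubst, Matrix.one_apply]
  map_mul' g h := by
    apply MvPolynomial.algHom_ext
    intro p
    simp only [linSubst, mul_inv_rev, map_mul, MvPolynomial.aeval_X, AlgHom.mul_apply,
      Matrix.mul_apply, map_sum, MvPolynomial.algHom_C, MvPolynomial.algebraMap_eq,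
      Finset.sum_mul, Finset.mul_sum]
    rw [Finset.sum_comm]
    exact Finset.sum_congr rfl fun i _ => Finset.sum_congr rfl fun j _ => by ring

/-- The induced action of `Γ ≀ Sₙ` on `K n` by field automorphisms. -/
def wreathAut (Γ : Subgroup SL2) (n : ℕ) : Wreath Γ n →* (K n ≃ₐ[ℂ] K n) :=
  (IsFractionRing.fieldEquivOfAlgEquivHom (A := ℂ) (B := P n) ℂ (K n)).comp
    ((AlgEquiv.algHomUnitsEquiv ℂ (P n)).toMonoidHom.comp (wreathActP Γ n).toHomUnits)

theorem wreathAut_coord (Γ : Subgroup SL2) (n : ℕ) (g : Wreath Γ n) (p : Fin n × Fin 2) :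
    wreathAut Γ n g (coord p) = ∑ q, wreathMatrix Γ n g⁻¹ p q • coord q := by
  have h : wreathAut Γ n g (coord p) =
      algebraMap (P n) (K n) (linSubst (wreathMatrix Γ n g⁻¹) (MvPolynomial.X p)) :=
    IsFractionRing.fieldEquivOfAlgEquiv_algebraMap _ _ _ _ _
  rw [h, linSubst, MvPolynomial.aeval_X, map_sum]
  refine Finset.sum_congr rfl fun q _ => ?_
  rw [map_mul, Algebra.smul_def, ← MvPolynomial.algebraMap_eq,
    ← IsScalarTower.algebraMap_apply]
  rfl

theorem wreathAut_isPoissonAut (Γ : Subgroup SL2) (n : ℕ) (g : Wreath Γ n) :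
    IsPoissonAut (wreathAut Γ n g) := by
  have hc : ∀ i a, wreathAut Γ n g (coord (i, a)) =
      ∑ c, ((g⁻¹.left i : SL2) : Matrix (Fin 2) (Fin 2) ℂ) a c • coord (g⁻¹.right⁻¹ i, c) := by
    intro i a
    rw [wreathAut_coord, Fintype.sum_prod_type, Finset.sum_eq_single (g⁻¹.right⁻¹ i)]
    · simp [wreathMatrix, wreathMat]
    · intro k _ hk
      refine Finset.sum_eq_zero fun c _ => ?_
      have : g.right i ≠ k := by simpa using hk.symm
      simp [wreathMatrix, wreathMat, this]
    · simp
  apply isPoissonAut_of_coord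
  rintro ⟨i, a⟩ ⟨j, b⟩
  rw [hc, hc]
  generalize g⁻¹.right⁻¹ = τ
  simp only [Fin.sum_univ_two, ← ham_apply, map_add, Derivation.map_smul]
  simp only [ham_apply, bracket_coord_zero, bracket_coord_one, map_add, Derivation.map_smul,
    partialD_coord]
  by_cases hij : i = j
  · subst hij
    generalize (g⁻¹.left i : SL2) = A
    have hdet := Matrix.det_fin_two (A : Matrix (Fin 2) (Fin 2) ℂ)
    rw [Matrix.SpecialLinearGroup.det_coe] at hdet
    have hdet' := congrArg (algebraMap ℂ (K n)) hdet
    simp only [map_one, map_sub, map_mul] at hdet'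
    fin_cases a <;> fin_cases b <;>
      simp [bracket_coord_zero, bracket_coord_one, partialD_coord, Algebra.smul_def]
    · ring
    · linear_combination hdet'
    · linear_combination -hdet'
    · ring
  · have h1 : ¬ τ i = τ j := fun h => hij (τ.injective h)
    fin_cases b <;>
      simp [bracket_coord_zero, bracket_coord_one, partialD_coord, hij, h1]

/-- The action of `Γ` on `K 1`, `(γ f)(p) = f (γ⁻¹ p)`. -/
def gammaAut (Γ : Subgroup SL2) : Γ →* (K 1 ≃ₐ[ℂ] K 1) :=
  (wreathAut Γ 1).comp (SemidirectProduct.inl.comp (Pi.constMonoidHom (Fin 1) Γ))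

/-- `(K n) ^ (Γ ≀ Sₙ)`. -/
abbrev KWreath (Γ : Subgroup SL2) (n : ℕ) : IntermediateField ℂ (K n) :=
  IntermediateField.fixedField (wreathAut Γ n).range

/-- `(K 1) ^ Γ`. -/
abbrev KGamma (Γ : Subgroup SL2) : IntermediateField ℂ (K 1) :=
  IntermediateField.fixedField (gammaAut Γ).range

instance instPoissonKWreath (Γ : Subgroup SL2) (n : ℕ) : PoissonAlgebra ℂ (KWreath Γ n) :=
  invariantsPoisson _ (by rintro _ ⟨g, rfl⟩; exact wreathAut_isPoissonAut Γ n g)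

instance instPoissonKGamma (Γ : Subgroup SL2) : PoissonAlgebra ℂ (KGamma Γ) :=
  invariantsPoisson _ (by rintro _ ⟨g, rfl⟩; exact wreathAut_isPoissonAut Γ 1 _)

/-! ### The generators -/

/-- `(u, v)` is a pair of canonical generators of `(K 1) ^ Γ`: `u ↦ x`, `v ↦ y` defines an
isomorphism of Poisson fields from `(K 1) ^ Γ` to `K 1`. -/
def IsCanonicalPair (Γ : Subgroup SL2) (u v : K 1) : Prop :=
  ∃ e : PoissonEquiv ℂ (KGamma Γ) (K 1),
    ((e.toAlgEquiv.symm (x 0) : KGamma Γ) : K 1) = u ∧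
    ((e.toAlgEquiv.symm (y 0) : KGamma Γ) : K 1) = v

/-- `t = y / x`. -/
def ratio : K 1 := y 0 / x 0

/-- `ℂ(t) ^ Γ`, the invariant rational functions of `t = y / x`. -/
def ratioInvariants (Γ : Subgroup SL2) : IntermediateField ℂ (K 1) :=
  IntermediateField.adjoin ℂ {ratio} ⊓ KGamma Γ

/-- `∏ (s - a)` over the `Γ`-orbit of `t = y / x`. -/
def orbitProduct (Γ : Subgroup SL2) (a : ℂ) : K 1 :=
  ∏ᶠ s ∈ Set.range fun g : Γ => gammaAut Γ g ratio, (s - algebraMap ℂ (K 1) a)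

/-- A linear form in `x, y` that spans a `Γ`-stable line. -/
def IsEigenform (Γ : Subgroup SL2) (l : K 1) : Prop :=
  (∃ α β : ℂ, l = α • x 0 + β • y 0) ∧ ∀ g : Γ, ∃ c : ℂ, gammaAut Γ g l = c • l

/-- The explicit generators of `(K 1) ^ Γ`. In the second case `v` is a function of `t = y / x`,
and `x * ∂v/∂y` is its derivative `dv/dt`. -/
inductive ExplicitPair (Γ : Subgroup SL2) : K 1 → K 1 → Prop
  | cyclic (l₁ l₂ : K 1) (h₁ : IsEigenform Γ l₁) (h₂ : IsEigenform Γ l₂)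
      (h : bracket l₁ l₂ = 1) :
      ExplicitPair Γ (l₁ / ((Nat.card Γ : K 1) * l₂ ^ (Nat.card Γ - 1))) (l₂ ^ Nat.card Γ)
  | even (v : K 1) (hΓ : (-1 : SL2) ∈ Γ)
      (hv : IntermediateField.adjoin ℂ {v} = ratioInvariants Γ) :
      ExplicitPair Γ (x 0 ^ 2 / (2 * (x 0 * partialD (0, 1) v))) v

/-- The embedding `P 1 → K n` as functions of the `i`-th factor: `x ↦ xᵢ`, `y ↦ yᵢ`. -/
def factorP {n : ℕ} (i : Fin n) : P 1 →ₐ[ℂ] K n :=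
  (Algebra.algHom ℂ (P n) (K n)).comp (MvPolynomial.rename fun p : Fin 1 × Fin 2 => (i, p.2))

theorem factorP_injective {n : ℕ} (i : Fin n) : Function.Injective (factorP i) := by
  have h : Function.Injective (MvPolynomial.rename (R := ℂ)
      fun p : Fin 1 × Fin 2 => (i, p.2)) := by
    refine MvPolynomial.rename_injective _ ?_
    rintro ⟨a, b⟩ ⟨c, d⟩ h
    exact Prod.ext (Subsingleton.elim _ _) (Prod.ext_iff.mp h).2
  intro f g hfg
  exact h (IsFractionRing.injective (P n) (K n) hfg)

/-- The embedding `K 1 → K n` as functions of the `i`-th factor: `x ↦ xᵢ`, `y ↦ yᵢ`. -/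
def factor {n : ℕ} (i : Fin n) : K 1 →ₐ[ℂ] K n :=
  IsFractionRing.liftAlgHom (factorP_injective i)

/-- The elementary symmetric polynomial `e_{j+1}` in `n` variables, `j = 0, …, n - 1`. -/
def elem (n : ℕ) (j : Fin n) : MvPolynomial (Fin n) ℂ :=
  MvPolynomial.esymm (Fin n) ℂ (j + 1)

/-- The Jacobian matrix `(∂e_j / ∂z_i)_{i j}` of the elementary symmetric polynomials, evaluated
at `z_i = v_i`, where `v_i` is the copy of `v` in the `i`-th factor. -/
def jacobian (n : ℕ) (v : K 1) : Matrix (Fin n) (Fin n) (K n) :=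
  Matrix.of fun i j => MvPolynomial.aeval (fun k => factor k v) (MvPolynomial.pderiv i (elem n j))

/-- `V_j = e_j (v_1, …, v_n)`. -/
def bigV (n : ℕ) (v : K 1) (j : Fin n) : K n :=
  MvPolynomial.aeval (fun k => factor k v) (elem n j)

/-- `U_i = ∑_j (M⁻¹)_{ij} u_j` for the Jacobian matrix `M`. -/
def bigU (n : ℕ) (u v : K 1) (i : Fin n) : K n :=
  ∑ j, (jacobian n v)⁻¹ i j * factor j u

end PoissonNoether

end

/-!
A family in `K n` that satisfies the canonical relations is algebraically independent, since the
derivations `{a, ·}` separate its members. It therefore defines a Poisson embedding `K n → K n`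
over whose image `K n` is algebraic. Such an embedding identifies `K n` with the fixed field of a
group of Poisson automorphisms as soon as the family is invariant and every embedding of `K n` into
an algebraic closure that fixes the family comes from the group.

For a pair of eigenforms it is enough to count degrees: `K 1` is generated over `ℂ(u, v)` by an
`m`-th root of `v`. If `-1 ∈ Γ` and `v` generates `ℂ(t)^Γ`, then an embedding that fixes `v` moves
`t` within its `Γ`-orbit, and fixing `u` determines `x` up to a sign, which is absorbed by `-1`.
Such a `v` is given by the orbit product, by comparing degrees over `ℂ(t)^Γ`. If `-1 ∉ Γ`, then
`Γ` has odd order; by orthogonality of characters `ℂ²` is then reducible, hence a sum of two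
eigenlines.

For the wreath product, a derivation that kills `V₁, …, Vₙ` kills the algebraic elements `vᵢ`. This
shows that `M` is invertible and that `{Uᵢ, Uⱼ} = 0`: this bracket is again a combination of
`u₁, …, uₙ` over `ℂ(v₁, …, vₙ)`, so it is determined by its brackets with the `vₖ`. An embedding
that fixes all `Uᵢ` and `Vᵢ` permutes the roots `vᵢ` of `∏ (X - vᵢ)`, hence in the same way the
`uᵢ`, so on each factor of `K n` it agrees up to the permutation with an element of `Γ`.
-/

noncomputable section

namespace PoissonNoether

open IntermediateField

section Fields

open Polynomial

variable {k E Ω ι : Type*} [Field k] [Field E] [Algebra k E] [Field Ω]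

/-! ### Coefficients of products of linear factors -/

theorem exists_map_eq_of_map_prod_X_sub_C_eq [Fintype ι] (σ τ : E →+* Ω) (s : ι → E)
    (h : (∏ i, (X - C (s i))).map σ = (∏ i, (X - C (s i))).map τ) (i : ι) :
    ∃ j, σ (s i) = τ (s j) := by
  have hroot : ((∏ i, (X - C (s i))).map σ).eval (σ (s i)) = 0 := by
    rw [eval_map_apply, eval_prod, Finset.prod_eq_zero (Finset.mem_univ i) (by simp), map_zero]
  rw [h, Polynomial.map_prod, eval_prod, Finset.prod_eq_zero_iff] at hroot
  obtain ⟨j, -, hj⟩ := hroot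
  exact ⟨j, by simpa [sub_eq_zero] using hj⟩

theorem coeff_prod_X_sub_C_mem [Fintype ι] {L : IntermediateField k E} {s : ι → E}
    (hs : ∀ i, s i ∈ L) (m : ℕ) : (∏ i, (X - C (s i))).coeff m ∈ L := by
  have hcoeff : (∏ i, (X - C (algebraMap L E ⟨s i, hs i⟩))).coeff m =
      algebraMap L E ((∏ i, (X - C (⟨s i, hs i⟩ : L))).coeff m) := by
    simp [← coeff_map, Polynomial.map_prod]
  exact hcoeff ▸ SetLike.coe_mem _

theorem coeff_prod_X_sub_C_mem_of_esymm_mem {n : ℕ} {L : IntermediateField k E} {s : Fin n → E}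
    (hs : ∀ j : Fin n, MvPolynomial.aeval s (MvPolynomial.esymm (Fin n) k (j + 1)) ∈ L) (m : ℕ) :
    (∏ i, (X - C (s i))).coeff m ∈ L := by
  rcases lt_or_ge n m with hm | hm
  · rw [coeff_eq_zero_of_natDegree_lt (by simpa using hm)]
    exact zero_mem L
  have hprod : ∏ i, (X - C (s i)) = ((Finset.univ.val.map s).map fun r => X - C r).prod := by
    rw [Multiset.map_map]
    rfl
  have hcard : (Finset.univ.val.map s).card = n := by simp
  rw [hprod, Multiset.prod_X_sub_C_coeff _ (hcard.symm ▸ hm), hcard]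
  refine mul_mem (pow_mem (neg_mem (one_mem L)) _) ?_
  rw [← MvPolynomial.aeval_esymm_eq_multiset_esymm (Fin n) k]
  rcases hr : n - m with _ | r
  · simp
  · exact hs ⟨r, by omega⟩

theorem isAlgebraic_of_coeff_prod_X_sub_C_mem [Fintype ι] {L : IntermediateField k E} {s : ι → E}
    (h : ∀ m, (∏ i, (X - C (s i))).coeff m ∈ L) (i : ι) : IsAlgebraic L (s i) := by
  obtain ⟨q, hq⟩ := (lifts_iff_coeff_lifts (f := algebraMap L E) _).2 fun m => ⟨⟨_, h m⟩, rfl⟩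
  have hq : q.map (algebraMap L E) = ∏ i, (X - C (s i)) := hq
  refine ⟨q, ?_, ?_⟩
  · rintro rfl
    rw [Polynomial.map_zero] at hq
    exact (monic_prod_of_monic _ _ fun i _ => monic_X_sub_C (s i)).ne_zero hq.symm
  · rw [aeval_def, ← eval_map, hq, eval_prod, Finset.prod_eq_zero (Finset.mem_univ i) (by simp)]

theorem natDegree_prod_le_card {k ι : Type*} [CommSemiring k] {s : Finset ι} {f : ι → k[X]}
    (hf : ∀ i, (f i).natDegree ≤ 1) : (∏ i ∈ s, f i).natDegree ≤ s.card :=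
  (natDegree_prod_le s f).trans ((Finset.sum_le_sum fun i _ => hf i).trans (by simp))

/-! ### Intermediate fields -/

theorem aeval_mem_adjoin_simple (t : E) (q : k[X]) : aeval t q ∈ k⟮t⟯ :=
  algebra_adjoin_le_adjoin k {t} (aeval_mem_adjoin_singleton k t)

theorem eqOn_adjoin [Algebra k Ω] {S : Set E} {σ τ : E →ₐ[k] Ω} (h : Set.EqOn σ τ S) :
    Set.EqOn σ τ (adjoin k S) := by
  have hext : σ.comp (adjoin k S).val = τ.comp (adjoin k S).val :=
    adjoin_algHom_ext k fun s hs => h hs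
  exact fun f hf => DFunLike.congr_fun hext ⟨f, hf⟩

theorem map_inv_apply [Fintype ι] [DecidableEq ι] (φ : E →+* Ω) (A : Matrix ι ι E) (i j : ι) :
    φ (A⁻¹ i j) = (A.map φ)⁻¹ i j := by
  have hdet : (A.map φ).det = φ A.det := (φ.map_det A).symm
  have hadj : (A.map φ).adjugate = A.adjugate.map φ := (φ.map_adjugate A).symm
  rw [Matrix.inv_def, Matrix.inv_def, Ring.inverse_eq_inv', Ring.inverse_eq_inv', hdet, hadj]
  simp

theorem inv_apply_mem [Fintype ι] [DecidableEq ι] (L : IntermediateField k E) {A : Matrix ι ι E}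
    (hA : ∀ i j, A i j ∈ L) (i j : ι) : A⁻¹ i j ∈ L := by
  let B : Matrix ι ι L := Matrix.of fun i j => ⟨A i j, hA i j⟩
  exact map_inv_apply (algebraMap L E) B i j ▸ SetLike.coe_mem (B⁻¹ i j)

theorem mem_of_forall_algHom_eq [Algebra E Ω] [IsAlgClosed Ω] {L : IntermediateField k E}
    [Algebra.IsSeparable L E] {z : E} (h : ∀ τ : E →ₐ[L] Ω, τ z = algebraMap E Ω z) : z ∈ L := by
  have hz : IsIntegral L z := Algebra.IsIntegral.isIntegral z
  have hroots : (minpoly L z).rootSet Ω ⊆ {algebraMap E Ω z} := by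
    rw [← Algebra.IsAlgebraic.range_eval_eq_rootSet_minpoly (F := L) Ω z]
    rintro _ ⟨τ, rfl⟩
    exact h τ
  have hcard := card_rootSet_eq_natDegree (K := Ω) (Algebra.IsSeparable.isSeparable L z)
    (IsAlgClosed.splits _)
  have hdeg : (minpoly L z).natDegree ≤ 1 := by
    rw [← hcard, ← Nat.card_eq_fintype_card]
    exact (Nat.card_mono (Set.finite_singleton _) hroots).trans (by simp)
  have hdeg_pos := minpoly.natDegree_pos hz
  obtain ⟨c, hc⟩ := minpoly.mem_range_of_degree_eq_one L z <|
    (degree_eq_iff_natDegree_eq_of_pos one_pos).2 (le_antisymm hdeg hdeg_pos)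
  exact hc ▸ c.2

theorem eq_of_natDegree_minpoly_le {t : E} {L F : IntermediateField k E} (hLF : L ≤ F)
    (hF : F ≤ k⟮t⟯) (ht : IsIntegral L t)
    (h : (minpoly L t).natDegree ≤ (minpoly F t).natDegree) : L = F := by
  have relfinrank_eq (M : IntermediateField k E) (hM : M ≤ k⟮t⟯) (hMt : IsIntegral M t) :
      M.relfinrank k⟮t⟯ = (minpoly M t).natDegree := by
    rw [relfinrank_eq_finrank_of_le hM, extendScalars_adjoin, adjoin.finrank hMt]
  have htF : IsIntegral F t := ht.map_of_comp_eq (inclusion hLF).toRingHom (RingHom.id E) rfl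
  have htower := relfinrank_mul_relfinrank hLF hF
  rw [relfinrank_eq L (hLF.trans hF) ht, relfinrank_eq F hF htF] at htower
  have hle : L.relfinrank F ≤ 1 :=
    Nat.le_of_mul_le_mul_right (by simpa [htower] using h) (minpoly.natDegree_pos htF)
  have hne : L.relfinrank F ≠ 0 := by
    intro h0
    rw [h0, zero_mul] at htower
    exact (minpoly.natDegree_pos ht).ne htower
  exact le_antisymm hLF (relfinrank_eq_one_iff.mp (by omega))

theorem card_le_natDegree_minpoly {L : IntermediateField k E} {t : E} (ht : IsIntegral L t)
    {R : Finset ι} {s : ι → E →ₐ[k] E}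
    (hs : ∀ i, ∀ f ∈ L, s i f = f) (hR : Set.InjOn (fun i => s i t) R) :
    R.card ≤ (minpoly L t).natDegree := by
  classical
  rw [← Finset.card_image_of_injOn hR, ← natDegree_map (algebraMap L E)]
  refine card_le_degree_of_subset_roots fun r hr => ?_
  obtain ⟨i, -, rfl⟩ := Finset.mem_image.1 hr
  let s' : E →ₐ[L] E := { (s i).toRingHom with commutes' := fun c => hs i _ c.2 }
  rw [mem_roots_map (minpoly.ne_zero ht), ← aeval_def]
  exact (aeval_algHom_apply s' t _).trans (by rw [minpoly.aeval, map_zero])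

theorem minpoly_adjoin_simple_natDegree_le {t v : E} {N D : k[X]} {d : ℕ}
    (hN : N.natDegree ≤ d) (hD : D.natDegree ≤ d) (hv : v * aeval t D = aeval t N) (hv0 : v ≠ 0)
    {a : k} (hNa : N.eval a = 0) (hDa : D.eval a ≠ 0) :
    IsIntegral k⟮v⟯ t ∧ (minpoly k⟮v⟯ t).natDegree ≤ d := by
  set q : k⟮v⟯[X] := N.map (algebraMap k k⟮v⟯) -
    C (AdjoinSimple.gen k v) * D.map (algebraMap k k⟮v⟯)
  have hq0 : q ≠ 0 := by
    intro h
    have heval := congrArg (eval (algebraMap k k⟮v⟯ a)) h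
    simp only [q, eval_sub, eval_mul, eval_C, eval_map_apply, hNa, map_zero, zero_sub,
      eval_zero, neg_eq_zero, mul_eq_zero] at heval
    rcases heval with h | h
    · exact hv0 (congrArg Subtype.val h)
    · exact hDa (by simpa using h)
  have hqt : aeval t q = 0 := by
    simp [q, hv]
  have hqd : q.natDegree ≤ d := by
    refine (natDegree_sub_le _ _).trans (max_le (natDegree_map_le.trans hN) ?_)
    exact (natDegree_C_mul_le _ _).trans (natDegree_map_le.trans hD)
  exact ⟨IsAlgebraic.isIntegral ⟨q, hq0, hqt⟩,
    (natDegree_le_of_dvd (minpoly.dvd _ _ hqt) hq0).trans hqd⟩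

theorem finrank_le_of_pow_mem {L : IntermediateField k E} {l : E} {m : ℕ} (hm : m ≠ 0)
    (hl : l ^ m ∈ L) (htop : L⟮l⟯ = ⊤) :
    FiniteDimensional L E ∧ Module.finrank L E ≤ m := by
  have hmonic : (X ^ m - C (⟨l ^ m, hl⟩ : L)).Monic := monic_X_pow_sub_C _ hm
  have hroot : aeval l (X ^ m - C (⟨l ^ m, hl⟩ : L)) = 0 := by simp
  have hint : IsIntegral L l := ⟨_, hmonic, hroot⟩
  have hfin : FiniteDimensional L (⊤ : IntermediateField L E) :=
    htop ▸ adjoin.finiteDimensional hint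
  refine ⟨Module.Finite.equiv topEquiv.toLinearEquiv, ?_⟩
  rw [← finrank_top', ← htop, adjoin.finrank hint]
  exact (natDegree_le_of_dvd (minpoly.dvd L l hroot) hmonic.ne_zero).trans natDegree_X_pow_sub_C.le

/-! ### Fixed fields of finite groups -/

theorem pow_apply_eq_smul {s : E ≃ₐ[k] E} {l : E} {c : k} (h : s l = c • l) (m : ℕ) :
    (s ^ m) l = c ^ m • l := by
  induction m with
  | zero => simp
  | succ m ih => rw [pow_succ, AlgEquiv.mul_apply, h, map_smul, ih, smul_smul, pow_succ']

instance isGaloisGroup_fixedField (H : Subgroup (E ≃ₐ[k] E)) :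
    IsGaloisGroup H (fixedField H) E where
  faithful := inferInstance
  commutes := ⟨fun s c f => by
    change s.1 (c.1 * f) = c.1 * s.1 f
    rw [map_mul, (mem_fixedField_iff H _).mp c.2 s s.2]⟩
  isInvariant := ⟨fun f hf => ⟨⟨f, hf⟩, rfl⟩⟩

theorem exists_eq_comp_of_eqOn_fixedField [Algebra k Ω] {H : Subgroup (E ≃ₐ[k] E)} [Finite H]
    {σ τ : E →ₐ[k] Ω} (h : Set.EqOn σ τ (fixedField H)) : ∃ s ∈ H, ∀ f, σ f = τ (s f) := by
  let := τ.toRingHom.toAlgebra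
  have := IsGaloisGroup.isGalois H (fixedField H) E
  let σ' : E →ₐ[fixedField H] Ω := { σ.toRingHom with commutes' := fun c => h c.2 }
  obtain ⟨s, hs⟩ := ((IsGaloisGroup.mulEquivAlgEquiv H (fixedField H) E).toEquiv.trans
    (Normal.algHomEquivAut (fixedField H) Ω E).symm).surjective σ'
  exact ⟨s, s.2, fun f => (DFunLike.congr_fun hs f).symm⟩

theorem eq_fixedField_of_finrank_le {H : Subgroup (E ≃ₐ[k] E)} {L : IntermediateField k E}
    [FiniteDimensional L E] (hL : L ≤ fixedField H) (h : Module.finrank L E ≤ Nat.card H) :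
    L = fixedField H :=
  eq_of_le_of_finrank_le' hL <| h.trans (IsGaloisGroup.card_eq_finrank H (fixedField H) E).le

theorem eq_fixedField_of_forall_algHom [Algebra E Ω] [IsAlgClosed Ω] {H : Subgroup (E ≃ₐ[k] E)}
    {L : IntermediateField k E} [Algebra.IsSeparable L E] (hL : L ≤ fixedField H)
    (h : ∀ τ : E →ₐ[L] Ω, ∃ s ∈ H, ∀ f, τ f = algebraMap E Ω (s f)) : L = fixedField H := by
  refine le_antisymm hL fun f hf => mem_of_forall_algHom_eq (Ω := Ω) fun τ => ?_
  obtain ⟨s, hs, hτ⟩ := h τ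
  rw [hτ, (mem_fixedField_iff H f).mp hf s hs]

/-! ### Derivations -/

/-- The field of constants of a derivation `D`, i.e. its kernel. -/
def constants (D : Derivation k E E) : IntermediateField k E where
  carrier := {f | D f = 0}
  mul_mem' {f g} (hf : D f = 0) (hg : D g = 0) := by simp [hf, hg]
  add_mem' {f g} (hf : D f = 0) (hg : D g = 0) := by simp [hf, hg]
  algebraMap_mem' c := D.map_algebraMap c
  inv_mem' f (hf : D f = 0) := by simp [Derivation.leibniz_inv, hf]

theorem mem_constants {D : Derivation k E E} {f : E} : f ∈ constants D ↔ D f = 0 := Iff.rfl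

theorem mem_constants_of_isAlgebraic [CharZero E] {D : Derivation k E E} {t : E}
    (ht : IsAlgebraic (constants D) t) : t ∈ constants D := by
  let D' : Derivation (constants D) E E := Derivation.mk'
    { toFun := D
      map_add' := map_add D
      map_smul' := fun c f => by
        change D (c.1 * f) = c.1 * D f
        rw [Derivation.leibniz, mem_constants.mp c.2, smul_zero, add_zero, smul_eq_mul] }
    D.leibniz
  have hD := D'.map_aeval (minpoly (constants D) t) t
  rw [minpoly.aeval, map_zero] at hD
  have hsep := (minpoly.irreducible ht.isIntegral).separable.aeval_derivative_ne_zero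
    (minpoly.aeval _ t)
  exact (smul_eq_zero.mp hD.symm).resolve_left hsep

theorem derivation_mem_adjoin {S : Set E} {D : Derivation k E E}
    (hS : ∀ s ∈ S, D s ∈ adjoin k S) {f : E} (hf : f ∈ adjoin k S) : D f ∈ adjoin k S := by
  induction hf using adjoin_induction with
  | mem f hf => exact hS f hf
  | algebraMap c => simp
  | add f g _ _ hf hg => simpa using add_mem hf hg
  | inv f hf hDf =>
    rw [Derivation.leibniz_inv]
    exact mul_mem (neg_mem (pow_mem (inv_mem hf) 2)) hDf
  | mul f g hf hg hDf hDg =>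
    rw [Derivation.leibniz]
    exact add_mem (mul_mem hf hDg) (mul_mem hg hDf)

theorem derivation_aeval_eq_sum {R A : Type*} [CommRing R] [CommRing A] [Algebra R A] [Fintype ι]
    (D : Derivation R A A) (a : ι → A) (q : MvPolynomial ι R) :
    D (MvPolynomial.aeval a q) =
      ∑ i, MvPolynomial.aeval a (MvPolynomial.pderiv i q) * D (a i) := by
  classical
  induction q using MvPolynomial.induction_on with
  | C c => simp [MvPolynomial.algHom_C]
  | add p q hp hq => simp only [map_add, hp, hq, add_mul, Finset.sum_add_distrib]
  | mul_X p i hp =>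
    simp only [map_mul, MvPolynomial.aeval_X, Derivation.leibniz, hp, smul_eq_mul, Finset.mul_sum,
      MvPolynomial.pderiv_X, map_add, add_mul, Finset.sum_add_distrib]
    simp [Pi.single_apply, apply_ite, mul_assoc]

theorem algebraicIndependent_of_derivation [CharZero E] {a : ι → E} (D : ι → Derivation k E E)
    (hself : ∀ i, D i (a i) ≠ 0) (hne : ∀ i j, i ≠ j → D i (a j) = 0) :
    AlgebraicIndependent k a := by
  refine algebraicIndependent_of_finite_type' (algebraMap k E).injective fun t _ _ i hi halg => ?_
  have hle : Algebra.adjoin k (a '' t) ≤ (constants (D i)).toSubalgebra := by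
    refine Algebra.adjoin_le ?_
    rintro _ ⟨j, hj, rfl⟩
    exact hne i j fun hij => hi (hij ▸ hj)
  exact hself i (mem_constants_of_isAlgebraic (halg.tower_top_of_subalgebra_le hle))

end Fields

section PoissonField

variable {n : ℕ}

/-! ### The Poisson fields `K n` -/

theorem adjoin_range_coord : adjoin ℂ (Set.range (coord (n := n))) = ⊤ := by
  refine top_unique fun f _ => ?_
  have hpoly (q : P n) : algebraMap (P n) (K n) q ∈ adjoin ℂ (Set.range (coord (n := n))) := by
    have hq : algebraMap (P n) (K n) q = MvPolynomial.aeval coord q :=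
      DFunLike.congr_fun (MvPolynomial.aeval_unique (Algebra.algHom ℂ (P n) (K n))) q
    rw [hq]
    refine algebra_adjoin_le_adjoin ℂ _ ?_
    rw [Algebra.adjoin_range_eq_range_aeval]
    exact ⟨q, rfl⟩
  obtain ⟨a, b, -, rfl⟩ := IsFractionRing.div_surjective (A := P n) f
  exact div_mem (hpoly a) (hpoly b)

theorem algHom_ext_coord {B : Type*} [Field B] [Algebra ℂ B] {σ τ : K n →ₐ[ℂ] B}
    (h : ∀ p, σ (coord p) = τ (coord p)) : σ = τ :=
  AlgHom.ext fun f => eqOn_adjoin (Set.forall_mem_range.2 h)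
    (adjoin_range_coord.symm ▸ mem_top : f ∈ adjoin ℂ (Set.range coord))

theorem derivation_map_eq_sum {B : Type*} [Field B] [Algebra ℂ B] (φ : K n →ₐ[ℂ] B)
    (D : Derivation ℂ B B) (f : K n) : D (φ f) = ∑ p, φ (partialD p f) * D (φ (coord p)) := by
  have hf : f ∈ adjoin ℂ (Set.range (coord (n := n))) := adjoin_range_coord.symm ▸ mem_top
  induction hf using adjoin_induction with
  | mem f hf =>
    obtain ⟨q, rfl⟩ := hf
    simp [partialD_coord]
  | algebraMap c => simp
  | add f g _ _ hf hg => simp only [map_add, hf, hg, add_mul, Finset.sum_add_distrib]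
  | inv f _ hf =>
    simp only [map_inv₀, Derivation.leibniz_inv, hf, smul_eq_mul, map_mul, map_neg, map_pow,
      mul_assoc, Finset.mul_sum]
  | mul f g _ _ hf hg =>
    simp only [map_mul, Derivation.leibniz, hf, hg, smul_eq_mul, map_add, add_mul,
      Finset.sum_add_distrib, Finset.mul_sum, mul_assoc]

theorem bracket_self (f : K n) : bracket f f = 0 := PoissonAlgebra.pb_self (R := ℂ) f

theorem bracket_mul (f g h : K n) : bracket f (g * h) = g * bracket f h + h * bracket f g :=
  PoissonAlgebra.pb_mul (R := ℂ) f g h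

theorem mul_bracket (f g h : K n) : bracket (f * g) h = f * bracket g h + g * bracket f h := by
  rw [bracket_skew, bracket_mul, bracket_skew g, bracket_skew f]
  ring

theorem bracket_bracket (f g h : K n) :
    bracket (bracket f g) h = bracket f (bracket g h) - bracket g (bracket f h) := by
  have := DFunLike.congr_fun (ham_bracket f g) h
  rw [Derivation.commutator_apply] at this
  simpa only [ham_apply] using this.symm

theorem bracket_coord_coord (p q : Fin n × Fin 2) : ∃ c : ℂ,
    bracket (coord p) (coord q) = algebraMap ℂ (K n) c := by
  obtain ⟨i, b⟩ := q
  match b with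
  | 0 => exact ⟨-if p = (i, 1) then 1 else 0, by simp [bracket_coord_zero, partialD_coord]⟩
  | 1 => exact ⟨if p = (i, 0) then 1 else 0, by simp [bracket_coord_one, partialD_coord]⟩

theorem bracket_map_map_eq_sum {l m : ℕ} (φ : K l →ₐ[ℂ] K n) (ψ : K m →ₐ[ℂ] K n) (f : K l)
    (g : K m) : bracket (φ f) (ψ g) =
      ∑ q, ∑ p, ψ (partialD q g) * φ (partialD p f) * bracket (φ (coord p)) (ψ (coord q)) := by
  rw [← ham_apply, derivation_map_eq_sum]
  refine Finset.sum_congr rfl fun q _ => ?_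
  rw [ham_apply, bracket_skew, ← ham_apply, derivation_map_eq_sum,
    ← Finset.sum_neg_distrib, Finset.mul_sum]
  refine Finset.sum_congr rfl fun p _ => ?_
  rw [ham_apply, bracket_skew, mul_neg, mul_neg, mul_neg, neg_neg, mul_assoc]

theorem map_bracket_of_coord {m : ℕ} (φ : K m →ₐ[ℂ] K n)
    (h : ∀ p q, φ (bracket (coord p) (coord q)) = bracket (φ (coord p)) (φ (coord q)))
    (f g : K m) : φ (bracket f g) = bracket (φ f) (φ g) := by
  have hid := bracket_map_map_eq_sum (AlgHom.id ℂ (K m)) (AlgHom.id ℂ (K m)) f g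
  simp only [AlgHom.coe_id, id_eq] at hid
  rw [hid, bracket_map_map_eq_sum]
  simp only [map_sum, map_mul, h]

theorem bracket_eq_zero_of_mem_adjoin {S : Set (K n)} {f g : K n}
    (h : ∀ s ∈ S, bracket f s = 0) (hg : g ∈ adjoin ℂ S) : bracket f g = 0 := by
  have hle : adjoin ℂ S ≤ constants (ham f) :=
    adjoin_le_iff.2 fun s hs => mem_constants.2 ((ham_apply f s).trans (h s hs))
  exact (ham_apply f g).symm.trans (mem_constants.1 (hle hg))

theorem bracket_eq_zero_of_mem_adjoin_of_mem_adjoin {S : Set (K n)} {f g : K n}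
    (h : ∀ s ∈ S, ∀ t ∈ S, bracket s t = 0) (hf : f ∈ adjoin ℂ S) (hg : g ∈ adjoin ℂ S) :
    bracket f g = 0 := by
  refine bracket_eq_zero_of_mem_adjoin (fun t ht => ?_) hg
  rw [bracket_skew, bracket_eq_zero_of_mem_adjoin (h t ht) hf, neg_zero]

theorem ne_zero_of_bracket_eq_one {f g : K n} (h : bracket f g = 1) : g ≠ 0 := by
  rintro rfl
  simp [bracket] at h

/-! ### Canonical coordinates -/

/-- A family in `K n`, indexed like the coordinate functions, that satisfies the canonical
relations `{xᵢ, xⱼ} = {yᵢ, yⱼ} = 0` and `{xᵢ, yⱼ} = δᵢⱼ`. -/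
def IsCanonical (a : Fin n × Fin 2 → K n) : Prop :=
  ∀ p q, bracket (a p) (a q) = bracket (coord p) (coord q)

namespace IsCanonical

variable {a : Fin n × Fin 2 → K n} (ha : IsCanonical a)

include ha

-- The derivation `{a q, ·}`, for `a q` conjugate to `a p`, kills the whole family except `a p`.
theorem algebraicIndependent : AlgebraicIndependent ℂ a := by
  refine algebraicIndependent_of_derivation (fun p => ham (a (p.1, 1 - p.2))) ?_ ?_
  · rintro ⟨i, b⟩
    rw [ham_apply, ha]
    fin_cases b <;> simp [bracket_coord_zero, bracket_coord_one, partialD_coord]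
  · rintro ⟨i, b⟩ ⟨j, c⟩ hne
    rw [ham_apply, ha]
    fin_cases b <;> fin_cases c <;>
      simp_all [bracket_coord_zero, bracket_coord_one, partialD_coord]

theorem isAlgebraic : Algebra.IsAlgebraic (adjoin ℂ (Set.range a)) (K n) := by
  have : Algebra.IsAlgebraic (P n) (K n) := IsLocalization.isAlgebraic (K n) (nonZeroDivisors (P n))
  have htrdeg := trdeg_add_eq (R := ℂ) (S := P n) (A := K n)
  rw [trdeg_eq_zero (R := P n), add_zero, MvPolynomial.trdeg_of_isDomain,
    Cardinal.lift_id] at htrdeg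
  exact (ha.algebraicIndependent.isTranscendenceBasis_of_trdeg_le_of_finite
    htrdeg.ge).isAlgebraic_field

/-- The substitution `coord p ↦ a p`, as an endomorphism of the Poisson field `K n`. -/
def subst : K n →ₐ[ℂ] K n :=
  IsFractionRing.liftAlgHom (g := MvPolynomial.aeval a)
    (algebraicIndependent_iff_injective_aeval.mp ha.algebraicIndependent)

theorem subst_coord (p : Fin n × Fin 2) : ha.subst (coord p) = a p := by
  rw [subst, coord, IsFractionRing.liftAlgHom_apply, IsFractionRing.lift_algebraMap]
  exact MvPolynomial.aeval_X a p

theorem subst_bracket (f g : K n) :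
    ha.subst (bracket f g) = bracket (ha.subst f) (ha.subst g) := by
  refine map_bracket_of_coord _ (fun p q => ?_) f g
  obtain ⟨c, hc⟩ := bracket_coord_coord p q
  rw [ha.subst_coord, ha.subst_coord, ha, hc, AlgHom.commutes]

theorem subst_fieldRange : ha.subst.fieldRange = adjoin ℂ (Set.range a) := by
  rw [AlgHom.fieldRange_eq_map, ← adjoin_range_coord, adjoin_map, ← Set.range_comp]
  exact congrArg _ (congrArg _ (funext ha.subst_coord))

theorem adjoin_eq_fixedField {H : Subgroup (K n ≃ₐ[ℂ] K n)}
    (hH : ∀ p, a p ∈ fixedField H)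
    (hτ : ∀ τ : K n →ₐ[ℂ] AlgebraicClosure (K n),
      (∀ p, τ (a p) = algebraMap (K n) (AlgebraicClosure (K n)) (a p)) →
      ∃ s ∈ H, ∀ f, τ f = algebraMap (K n) (AlgebraicClosure (K n)) (s f)) :
    adjoin ℂ (Set.range a) = fixedField H := by
  have := ha.isAlgebraic
  refine eq_fixedField_of_forall_algHom (Ω := AlgebraicClosure (K n))
    (adjoin_le_iff.2 (Set.range_subset_iff.2 hH)) fun τ => ?_
  exact hτ (τ.restrictScalars ℂ) fun p => τ.commutes ⟨a p, subset_adjoin ℂ _ ⟨p, rfl⟩⟩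

theorem exists_poissonEquiv {H : Subgroup (K n ≃ₐ[ℂ] K n)} (hP : ∀ s ∈ H, IsPoissonAut s)
    (h : adjoin ℂ (Set.range a) = fixedField H) :
    letI := invariantsPoisson H hP
    ∃ e : PoissonEquiv ℂ (fixedField H) (K n),
      ∀ p, (e.toAlgEquiv.symm (coord p) : K n) = a p := by
  let := invariantsPoisson H hP
  let e : K n ≃ₐ[ℂ] fixedField H := (AlgEquiv.ofInjectiveField ha.subst).trans
    (equivOfEq (ha.subst_fieldRange.trans h))
  have he (f : K n) : (e f : K n) = ha.subst f := rfl
  refine ⟨⟨e.symm, fun f g => ?_⟩, fun p => ha.subst_coord p⟩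
  rw [AlgEquiv.symm_apply_eq]
  refine Subtype.ext ?_
  change bracket f.1 g.1 = ha.subst (bracket (e.symm f) (e.symm g))
  rw [ha.subst_bracket, ← he, ← he, e.apply_symm_apply, e.apply_symm_apply]

end IsCanonical

end PoissonField

section Representation

open Matrix Module

/-! ### Two-dimensional representations of groups of odd order -/

theorem exists_eigenvector_of_finrank_eq_one {k G V : Type*} [Field k] [Monoid G] [AddCommGroup V]
    [Module k V] {ρ : Representation k G V} {W : Subrepresentation ρ}
    (hW : finrank k W.toSubmodule = 1) :
    ∃ w ∈ W, w ≠ 0 ∧ ∀ g, ∃ c : k, ρ g w = c • w := by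
  obtain ⟨⟨w, hw⟩, hw0, hspan⟩ := finrank_eq_one_iff'.mp hW
  refine ⟨w, hw, fun h => hw0 (Subtype.ext h), fun g => ?_⟩
  obtain ⟨c, hc⟩ := hspan ⟨ρ g w, W.apply_mem_toSubmodule g hw⟩
  exact ⟨c, (congrArg Subtype.val hc).symm⟩

theorem finrank_eq_one_of_isCompl {k V : Type*} [Field k] [AddCommGroup V] [Module k V]
    [FiniteDimensional k V] (hV : finrank k V = 2) {W Z : Submodule k V} (h : IsCompl W Z)
    (hW : W ≠ ⊥) (hZ : Z ≠ ⊥) : finrank k W = 1 ∧ finrank k Z = 1 := by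
  have := Submodule.finrank_add_eq_of_isCompl h
  have := Submodule.one_le_finrank_iff.2 hW
  have := Submodule.one_le_finrank_iff.2 hZ
  omega

theorem det_ne_zero_of_disjoint {k : Type*} [Field k] {W Z : Submodule k (Fin 2 → k)}
    (h : Disjoint W Z) {w z : Fin 2 → k} (hw : w ∈ W) (hz : z ∈ Z) (hw0 : w ≠ 0) (hz0 : z ≠ 0) :
    w 0 * z 1 - w 1 * z 0 ≠ 0 := by
  intro hdet
  have hsmul (i : Fin 2) : z i • w = w i • z := by
    ext j
    fin_cases i <;> fin_cases j <;> grind [Pi.smul_apply, smul_eq_mul]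
  refine hw0 (funext fun i => ?_)
  have hmem : z i • w ∈ W ⊓ Z := ⟨W.smul_mem _ hw, hsmul i ▸ Z.smul_mem _ hz⟩
  rw [h.eq_bot, Submodule.mem_bot, hsmul] at hmem
  exact (smul_eq_zero.mp hmem).resolve_right hz0

section SpecialLinearGroup

variable {R : Type*} [CommRing R]

theorem trace_inv (g : SpecialLinearGroup (Fin 2) R) :
    ((g⁻¹ : SpecialLinearGroup (Fin 2) R) : Matrix (Fin 2) (Fin 2) R).trace =
      (g : Matrix (Fin 2) (Fin 2) R).trace := by
  rw [Matrix.SpecialLinearGroup.coe_inv, adjugate_fin_two, trace_fin_two, trace_fin_two]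
  exact add_comm _ _

theorem trace_sq (g : SpecialLinearGroup (Fin 2) R) :
    ((g ^ 2 : SpecialLinearGroup (Fin 2) R) : Matrix (Fin 2) (Fin 2) R).trace =
      (g : Matrix (Fin 2) (Fin 2) R).trace ^ 2 - 2 := by
  have hdet := g.det_coe
  rw [det_fin_two] at hdet
  rw [Matrix.SpecialLinearGroup.coe_pow, sq, trace_fin_two, trace_fin_two, mul_apply, mul_apply,
    Fin.sum_univ_two, Fin.sum_univ_two]
  linear_combination -2 * hdet

theorem eq_one_or_eq_neg_one_of_sq_eq_one [IsDomain R] [NeZero (2 : R)]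
    {g : SpecialLinearGroup (Fin 2) R} (h : g ^ 2 = 1) : g = 1 ∨ g = -1 := by
  have hdet := g.det_coe
  have hinv : (g : Matrix (Fin 2) (Fin 2) R) = (g : Matrix (Fin 2) (Fin 2) R).adjugate := by
    rw [← Matrix.SpecialLinearGroup.coe_inv, ← eq_inv_of_mul_eq_one_left (sq g ▸ h)]
  rw [adjugate_fin_two] at hinv
  have hdiag : g 0 0 = g 1 1 := congrFun₂ hinv 0 0
  have h01 : g 0 1 = 0 := by
    have : g 0 1 = -g 0 1 := congrFun₂ hinv 0 1
    exact (mul_eq_zero.mp (by linear_combination this : 2 * g 0 1 = 0)).resolve_left two_ne_zero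
  have h10 : g 1 0 = 0 := by
    have : g 1 0 = -g 1 0 := congrFun₂ hinv 1 0
    exact (mul_eq_zero.mp (by linear_combination this : 2 * g 1 0 = 0)).resolve_left two_ne_zero
  rw [det_fin_two, h01, zero_mul, sub_zero, hdiag, mul_self_eq_one_iff] at hdet
  refine hdet.imp (fun h11 => ?_) fun h11 => ?_ <;> ext i j <;> fin_cases i <;> fin_cases j <;>
    simp [h01, h10, h11, hdiag]

end SpecialLinearGroup

theorem odd_card_of_neg_one_notMem {Γ : Subgroup SL2} [Finite Γ] (h : (-1 : SL2) ∉ Γ) :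
    Odd (Nat.card Γ) := by
  by_contra heven
  obtain ⟨g, hg⟩ := exists_prime_orderOf_dvd_card' 2 (Nat.not_odd_iff_even.mp heven).two_dvd
  obtain ⟨hsq, hg1⟩ := orderOf_eq_prime_iff.mp hg
  rcases eq_one_or_eq_neg_one_of_sq_eq_one (congrArg Subtype.val hsq) with h1 | h1
  · exact hg1 (Subtype.ext h1)
  · exact h (h1 ▸ g.2)

/-- The natural representation of `Γ` on `ℂ²`. -/
def naturalRep (Γ : Subgroup SL2) : Representation ℂ Γ (Fin 2 → ℂ) :=
  (toLinAlgEquiv' : Matrix (Fin 2) (Fin 2) ℂ ≃ₐ[ℂ] _).toAlgHom.toMonoidHom.comp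
    (Matrix.SpecialLinearGroup.coeMonoidHom.comp Γ.subtype)

variable {Γ : Subgroup SL2}

theorem character_naturalRep (g : Γ) :
    (naturalRep Γ).character g = (g.1 : Matrix (Fin 2) (Fin 2) ℂ).trace :=
  trace_toLin'_eq _

theorem character_naturalRep_inv (g : Γ) :
    (naturalRep Γ).character g⁻¹ = (naturalRep Γ).character g := by
  rw [character_naturalRep, character_naturalRep, Subgroup.coe_inv, trace_inv]

theorem character_naturalRep_sq (g : Γ) :
    (naturalRep Γ).character (g ^ 2) = (naturalRep Γ).character g ^ 2 - 2 := by
  rw [character_naturalRep, character_naturalRep, Subgroup.coe_pow, trace_sq]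

theorem isIrreducible_of_forall_eq_bot_or_eq_top {k G V : Type*} [Field k] [Monoid G]
    [AddCommGroup V] [Module k V] [Nontrivial V] {ρ : Representation k G V}
    (h : ∀ W : Subrepresentation ρ, W = ⊥ ∨ W = ⊤) : ρ.IsIrreducible where
  exists_pair_ne := ⟨⊥, ⊤, fun h => bot_ne_top (congrArg Subrepresentation.toSubmodule h)⟩
  eq_bot_or_eq_top := h

theorem sum_comp_pow {G M : Type*} [Group G] [Fintype G] [AddCommMonoid M] {d : ℕ}
    (hd : (Nat.card G).Coprime d) (f : G → M) : ∑ g, f (g ^ d) = ∑ g, f g :=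
  (powCoprime hd).sum_comp f

theorem sum_character_sq_of_isIrreducible [Fintype Γ] (h : (naturalRep Γ).IsIrreducible) :
    ∑ g, (naturalRep Γ).character g ^ 2 = Nat.card Γ := by
  have hcard : (Nat.card Γ : ℂ) ≠ 0 := Nat.cast_ne_zero.mpr Nat.card_pos.ne'
  have := invertibleOfNonzero hcard
  have horth := Representation.char_orthonormal (naturalRep Γ) (naturalRep Γ)
  rw [if_pos ⟨.refl _⟩, inv_mul_eq_one₀ hcard] at horth
  rw [horth]
  refine Finset.sum_congr rfl fun g _ => ?_
  rw [sq, character_naturalRep_inv]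

-- Summing `χ(g²) = χ(g)² - 2` over `Γ` turns orthonormality of `χ` into `∑ χ(g) = -|Γ|`, as
-- squaring is a bijection; but `∑ χ(g) / |Γ|` is the dimension of the space of invariants.
theorem not_isIrreducible_naturalRep [Finite Γ] (hΓ : Odd (Nat.card Γ)) :
    ¬ (naturalRep Γ).IsIrreducible := by
  intro hirr
  have := Fintype.ofFinite Γ
  have hcard : (Nat.card Γ : ℂ) ≠ 0 := Nat.cast_ne_zero.mpr Nat.card_pos.ne'
  have := invertibleOfNonzero hcard
  have hsum : ∑ g, (naturalRep Γ).character g = -Nat.card Γ := by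
    calc ∑ g, (naturalRep Γ).character g = ∑ g, (naturalRep Γ).character (g ^ 2) :=
          (sum_comp_pow hΓ.coprime_two_right _).symm
      _ = ∑ g, ((naturalRep Γ).character g ^ 2 - 2) :=
          Finset.sum_congr rfl fun g _ => character_naturalRep_sq g
      _ = -Nat.card Γ := by
          rw [Finset.sum_sub_distrib, sum_character_sq_of_isIrreducible hirr, Finset.sum_const,
            Finset.card_univ, ← Nat.card_eq_fintype_card, nsmul_eq_mul]
          ring
  have hinv := (naturalRep Γ).card_inv_mul_sum_char_eq_finrank
  rw [hsum, mul_neg, inv_mul_cancel₀ hcard] at hinv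
  exact (Nat.cast_add_one_ne_zero (R := ℂ) _) (eq_neg_iff_add_eq_zero.mp hinv.symm)

theorem exists_eigenvectors [Finite Γ] (hΓ : Odd (Nat.card Γ)) : ∃ w z : Fin 2 → ℂ,
    (∀ g : Γ, ∃ c : ℂ, g.1.1 *ᵥ w = c • w) ∧ (∀ g : Γ, ∃ c : ℂ, g.1.1 *ᵥ z = c • z) ∧
      w 0 * z 1 - w 1 * z 0 = 1 := by
  have : NeZero (Nat.card Γ : ℂ) := ⟨Nat.cast_ne_zero.mpr Nat.card_pos.ne'⟩
  obtain ⟨W, hW, hW'⟩ : ∃ W : Subrepresentation (naturalRep Γ), W ≠ ⊥ ∧ W ≠ ⊤ := by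
    by_contra! h
    exact not_isIrreducible_naturalRep hΓ <| isIrreducible_of_forall_eq_bot_or_eq_top fun W =>
      or_iff_not_imp_left.2 (h W)
  obtain ⟨Z, hWZ⟩ := exists_isCompl W
  have hcompl : IsCompl W.toSubmodule Z.toSubmodule :=
    ⟨disjoint_iff.2 (congrArg Subrepresentation.toSubmodule hWZ.inf_eq_bot),
      codisjoint_iff.2 (congrArg Subrepresentation.toSubmodule hWZ.sup_eq_top)⟩
  have hZ : Z ≠ ⊥ := fun h => hW' (by rw [← hWZ.sup_eq_top, h, sup_bot_eq])
  obtain ⟨hW1, hZ1⟩ := finrank_eq_one_of_isCompl (finrank_fin_fun ℂ) hcompl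
    (fun h => hW (Subrepresentation.toSubmodule_injective h))
    (fun h => hZ (Subrepresentation.toSubmodule_injective h))
  obtain ⟨w, hw, hw0, hwΓ⟩ := exists_eigenvector_of_finrank_eq_one hW1
  obtain ⟨z, hz, hz0, hzΓ⟩ := exists_eigenvector_of_finrank_eq_one hZ1
  have hdet := det_ne_zero_of_disjoint hcompl.disjoint hw hz hw0 hz0
  refine ⟨w, (w 0 * z 1 - w 1 * z 0)⁻¹ • z, hwΓ, fun g => ?_, ?_⟩
  · obtain ⟨c, hc⟩ := hzΓ g
    exact ⟨c, by rw [mulVec_smul, smul_comm, ← hc]; rfl⟩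
  · simp only [Pi.smul_apply, smul_eq_mul]
    field_simp

end Representation

section CanonicalPairs

/-! ### The action of `Γ` on `K 1` -/

theorem partialD_zero_x : partialD (0, 0) (x 0 : K 1) = 1 := by simp [x, partialD_coord]

theorem partialD_zero_y : partialD (0, 0) (y 0 : K 1) = 0 := by simp [y, partialD_coord]

theorem partialD_one_x : partialD (0, 1) (x 0 : K 1) = 0 := by simp [x, partialD_coord]

theorem partialD_one_y : partialD (0, 1) (y 0 : K 1) = 1 := by simp [y, partialD_coord]

theorem bracket_one (f g : K 1) : bracket f g =
    partialD (0, 0) f * partialD (0, 1) g - partialD (0, 1) f * partialD (0, 0) g := by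
  simp [bracket]

theorem bracket_smul_smul {n : ℕ} (a c : ℂ) (f g : K n) :
    bracket (a • f) (c • g) = (a * c) • bracket f g := by
  simp only [bracket, Derivation.map_smul, smul_mul_smul_comm, ← smul_sub, ← Finset.smul_sum]

theorem bracket_linearForm (a b c d : ℂ) :
    bracket (a • x 0 + b • y 0 : K 1) (c • x 0 + d • y 0) =
      algebraMap ℂ (K 1) (a * d - b * c) := by
  rw [bracket_one]
  simp only [map_add, Derivation.map_smul, partialD_zero_x, partialD_zero_y, partialD_one_x,
    partialD_one_y, smul_zero, add_zero, zero_add]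
  simp only [Algebra.smul_def, mul_one, map_sub, map_mul]

theorem linearForm_injective {a b c d : ℂ}
    (h : a • (x 0 : K 1) + b • y 0 = c • x 0 + d • y 0) : a = c ∧ b = d := by
  have h0 := congrArg (partialD (0, 0)) h
  have h1 := congrArg (partialD (0, 1)) h
  simp only [map_add, Derivation.map_smul, partialD_zero_x, partialD_zero_y, partialD_one_x,
    partialD_one_y, smul_zero, add_zero, zero_add] at h0 h1
  exact ⟨smul_left_injective ℂ one_ne_zero h0, smul_left_injective ℂ one_ne_zero h1⟩

theorem x_mem_and_y_mem_of_bracket_eq_one {L : IntermediateField ℂ (K 1)} {l₁ l₂ : K 1}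
    (h₁ : ∃ a b : ℂ, l₁ = a • x 0 + b • y 0) (h₂ : ∃ a b : ℂ, l₂ = a • x 0 + b • y 0)
    (h : bracket l₁ l₂ = 1) (hl₁ : l₁ ∈ L) (hl₂ : l₂ ∈ L) : x 0 ∈ L ∧ y 0 ∈ L := by
  obtain ⟨a, b, rfl⟩ := h₁
  obtain ⟨c, d, rfl⟩ := h₂
  rw [bracket_linearForm, ← map_one (algebraMap ℂ (K 1))] at h
  have hdet : a * d - b * c = 1 := (algebraMap ℂ (K 1)).injective h
  have hx : d • (a • x 0 + b • y 0) - b • (c • x 0 + d • y 0 : K 1) = x 0 :=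
    calc _ = (a * d - b * c) • x 0 := by module
      _ = x 0 := by rw [hdet, one_smul]
  have hy : a • (c • x 0 + d • y 0) - c • (a • x 0 + b • y 0 : K 1) = y 0 :=
    calc _ = (a * d - b * c) • y 0 := by module
      _ = y 0 := by rw [hdet, one_smul]
  exact ⟨hx ▸ sub_mem (L.smul_mem hl₁) (L.smul_mem hl₂),
    hy ▸ sub_mem (L.smul_mem hl₂) (L.smul_mem hl₁)⟩

theorem eq_top_of_x_mem_of_y_mem {L : IntermediateField ℂ (K 1)} (hx : x 0 ∈ L) (hy : y 0 ∈ L) :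
    L = ⊤ := by
  rw [← top_le_iff, ← adjoin_range_coord, adjoin_le_iff]
  rintro _ ⟨⟨i, b⟩, rfl⟩
  obtain rfl := Subsingleton.elim i 0
  fin_cases b
  exacts [hx, hy]

theorem algHom_ext_xy {B : Type*} [Field B] [Algebra ℂ B] {σ τ : K 1 →ₐ[ℂ] B}
    (hx : σ (x 0) = τ (x 0)) (hy : σ (y 0) = τ (y 0)) : σ = τ := by
  refine algHom_ext_coord ?_
  rintro ⟨i, b⟩
  obtain rfl := Subsingleton.elim i 0
  fin_cases b
  exacts [hx, hy]

theorem wreathAut_coord_eq_sum {Γ : Subgroup SL2} {n : ℕ} (g : Wreath Γ n) (i : Fin n)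
    (b : Fin 2) : wreathAut Γ n g (coord (i, b)) =
      ∑ c, ((g⁻¹.left i : SL2) : Matrix (Fin 2) (Fin 2) ℂ) b c • coord (g.right i, c) := by
  rw [wreathAut_coord, Fintype.sum_prod_type, Finset.sum_eq_single (g.right i)]
  · simp [wreathMatrix, wreathMat]
  · intro k _ hk
    refine Finset.sum_eq_zero fun c _ => ?_
    simp [wreathMatrix, wreathMat, hk.symm]
  · simp

variable {Γ : Subgroup SL2}

theorem gammaAut_coord (g : Γ) (b : Fin 2) : gammaAut Γ g (coord (0, b)) =
    ∑ c, (((g : SL2)⁻¹ : SL2) : Matrix (Fin 2) (Fin 2) ℂ) b c • coord (0, c) := by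
  rw [gammaAut, MonoidHom.comp_apply, wreathAut_coord_eq_sum]
  rfl

theorem gammaAut_x (g : Γ) :
    gammaAut Γ g (x 0) = (g : SL2) 1 1 • x 0 - (g : SL2) 0 1 • y 0 := by
  rw [x, gammaAut_coord, Fin.sum_univ_two, Matrix.SpecialLinearGroup.coe_inv,
    Matrix.adjugate_fin_two]
  simp [y, sub_eq_add_neg]

theorem gammaAut_y (g : Γ) :
    gammaAut Γ g (y 0) = (g : SL2) 0 0 • y 0 - (g : SL2) 1 0 • x 0 := by
  rw [y, gammaAut_coord, Fin.sum_univ_two, Matrix.SpecialLinearGroup.coe_inv,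
    Matrix.adjugate_fin_two]
  simp [x, sub_eq_neg_add]

theorem isPoissonAut_gammaAut (g : Γ) : IsPoissonAut (gammaAut Γ g) :=
  wreathAut_isPoissonAut Γ 1 _

theorem mem_KGamma {f : K 1} : f ∈ KGamma Γ ↔ ∀ g, gammaAut Γ g f = f := by
  rw [mem_fixedField_iff]
  exact ⟨fun h g => h _ ⟨g, rfl⟩, by rintro h _ ⟨g, rfl⟩; exact h g⟩

theorem gammaAut_injective : Function.Injective (gammaAut Γ) := by
  intro g h hgh
  have hx := DFunLike.congr_fun hgh (x 0)
  have hy := DFunLike.congr_fun hgh (y 0)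
  rw [gammaAut_x, gammaAut_x, sub_eq_add_neg, sub_eq_add_neg, ← neg_smul, ← neg_smul] at hx
  rw [gammaAut_y, gammaAut_y, sub_eq_neg_add, sub_eq_neg_add, ← neg_smul, ← neg_smul] at hy
  obtain ⟨h11, h01⟩ := linearForm_injective hx
  obtain ⟨h10, h00⟩ := linearForm_injective hy
  refine Subtype.ext (Matrix.SpecialLinearGroup.ext _ _ fun i j => ?_)
  fin_cases i <;> fin_cases j
  exacts [h00, neg_injective h01, neg_injective h10, h11]

/-! ### Canonical pairs -/

theorem isCanonical_of_bracket_eq_one {u v : K 1} (h : bracket u v = 1) :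
    IsCanonical (fun p : Fin 1 × Fin 2 => (![u, v] : Fin 2 → K 1) p.2) := by
  rintro ⟨i, b⟩ ⟨j, c⟩
  obtain rfl := Subsingleton.elim i 0
  obtain rfl := Subsingleton.elim j 0
  fin_cases b <;> fin_cases c
  · simp [bracket_self]
  · simp [h, bracket_coord_one, partialD_coord]
  · simp [bracket_skew v u, h, bracket_coord_zero, partialD_coord]
  · simp [bracket_self]

theorem range_pair (u v : K 1) :
    Set.range (fun p : Fin 1 × Fin 2 => (![u, v] : Fin 2 → K 1) p.2) = {u, v} :=
  (Prod.snd_surjective.range_comp ![u, v]).trans (Matrix.range_cons_cons_empty u v ![])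

theorem isCanonicalPair_of_adjoin_eq {u v : K 1} (h : bracket u v = 1)
    (hadj : adjoin ℂ {u, v} = KGamma Γ) : IsCanonicalPair Γ u v := by
  obtain ⟨e, he⟩ := (isCanonical_of_bracket_eq_one h).exists_poissonEquiv
    (H := (gammaAut Γ).range) (by rintro _ ⟨g, rfl⟩; exact isPoissonAut_gammaAut g)
    ((congrArg _ (range_pair u v)).trans hadj)
  exact ⟨e, he (0, 0), he (0, 1)⟩

theorem adjoin_pair_eq_KGamma_of_forall_algHom {u v : K 1} (h : bracket u v = 1)
    (hu : u ∈ KGamma Γ) (hv : v ∈ KGamma Γ)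
    (hτ : ∀ τ : K 1 →ₐ[ℂ] AlgebraicClosure (K 1),
      τ u = algebraMap (K 1) (AlgebraicClosure (K 1)) u →
      τ v = algebraMap (K 1) (AlgebraicClosure (K 1)) v →
      ∃ g : Γ, ∀ f, τ f = algebraMap (K 1) (AlgebraicClosure (K 1)) (gammaAut Γ g f)) :
    adjoin ℂ {u, v} = KGamma Γ := by
  rw [← range_pair]
  refine (isCanonical_of_bracket_eq_one h).adjoin_eq_fixedField ?_ fun τ h => ?_
  · rintro ⟨i, b⟩
    fin_cases b
    exacts [hu, hv]
  · obtain ⟨g, hg⟩ := hτ τ (h (0, 0)) (h (0, 1))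
    exact ⟨_, ⟨g, rfl⟩, hg⟩

namespace IsCanonicalPair

variable {u v : K 1} (h : IsCanonicalPair Γ u v)

include h

theorem mem : u ∈ KGamma Γ ∧ v ∈ KGamma Γ := by
  obtain ⟨e, rfl, rfl⟩ := h
  exact ⟨Subtype.property _, Subtype.property _⟩

theorem bracket_eq_one : bracket u v = 1 := by
  obtain ⟨e, rfl, rfl⟩ := h
  have hmap := e.map_pb (e.toAlgEquiv.symm (x 0)) (e.toAlgEquiv.symm (y 0))
  rw [AlgEquiv.apply_symm_apply, AlgEquiv.apply_symm_apply] at hmap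
  have hxy : PoissonAlgebra.pb ℂ (x 0 : K 1) (y 0) = 1 := by
    change bracket _ _ = _
    simp [x, y, bracket_coord_one, partialD_coord]
  rw [hxy, ← map_one e.toAlgEquiv] at hmap
  exact congrArg Subtype.val (e.toAlgEquiv.injective hmap)

theorem eqOn_KGamma {Ω : Type*} [Field Ω] [Algebra ℂ Ω] {σ τ : K 1 →ₐ[ℂ] Ω}
    (hu : σ u = τ u) (hv : σ v = τ v) : Set.EqOn σ τ (KGamma Γ) := by
  obtain ⟨e, rfl, rfl⟩ := h
  have hcomp : (σ.comp (KGamma Γ).val).comp e.toAlgEquiv.symm.toAlgHom =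
      (τ.comp (KGamma Γ).val).comp e.toAlgEquiv.symm.toAlgHom := algHom_ext_xy hu hv
  intro f hf
  simpa using DFunLike.congr_fun hcomp (e.toAlgEquiv ⟨f, hf⟩)

end IsCanonicalPair

/-! ### Pairs of eigenforms -/

section Eigenforms

variable {l₁ l₂ : K 1} (h : bracket l₁ l₂ = 1)

include h

theorem eigenvalue_mul_eigenvalue_eq_one {g : Γ} {a c : ℂ} (ha : gammaAut Γ g l₁ = a • l₁)
    (hc : gammaAut Γ g l₂ = c • l₂) : a * c = 1 := by
  have hmap := isPoissonAut_gammaAut g l₁ l₂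
  rw [ha, hc, bracket_smul_smul, h, map_one] at hmap
  exact smul_left_injective ℂ one_ne_zero (hmap.symm.trans (one_smul ℂ 1).symm)

theorem bracket_div_pow_eq_one {m : ℕ} (hm : m ≠ 0) :
    bracket (l₁ / ((m : K 1) * l₂ ^ (m - 1))) (l₂ ^ m) = 1 := by
  have hl₂ : l₂ ≠ 0 := ne_zero_of_bracket_eq_one h
  set c : K 1 := m * l₂ ^ (m - 1) with hc
  have hc0 : c ≠ 0 := mul_ne_zero (Nat.cast_ne_zero.mpr hm) (pow_ne_zero _ hl₂)
  have hcl₂ : bracket l₂ c = 0 := by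
    refine bracket_eq_zero_of_mem_adjoin (S := {l₂}) (by simp [bracket_self]) ?_
    exact mul_mem (_root_.natCast_mem _ m) (pow_mem (mem_adjoin_simple_self ℂ l₂) _)
  have hu : bracket l₂ l₁ = c * bracket l₂ (l₁ / c) := by
    conv_lhs => rw [← div_mul_cancel₀ l₁ hc0]
    rw [bracket_mul, hcl₂, mul_zero, zero_add]
  calc bracket (l₁ / c) (l₂ ^ m) = c * bracket (l₁ / c) l₂ := by
        rw [← ham_apply, Derivation.leibniz_pow, ham_apply, hc, nsmul_eq_mul, smul_eq_mul,
          mul_assoc]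
    _ = -bracket l₂ l₁ := by rw [bracket_skew _ l₂, mul_neg, hu]
    _ = 1 := by rw [← bracket_skew, h]

end Eigenforms

theorem eigenvalue_pow_card_eq_one {g : Γ} {l : K 1} (hl : l ≠ 0) {c : ℂ}
    (hc : gammaAut Γ g l = c • l) : c ^ Nat.card Γ = 1 := by
  have hpow := pow_apply_eq_smul hc (Nat.card Γ)
  rw [← map_pow, pow_card_eq_one', map_one, AlgEquiv.one_apply] at hpow
  exact smul_left_injective ℂ hl (hpow.symm.trans (one_smul ℂ l).symm)

theorem eigenform_pow_card_mem {l : K 1} (hl : IsEigenform Γ l) : l ^ Nat.card Γ ∈ KGamma Γ := by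
  rcases eq_or_ne l 0 with rfl | hl0
  · exact pow_mem (zero_mem _) _
  refine mem_KGamma.2 fun g => ?_
  obtain ⟨c, hc⟩ := hl.2 g
  rw [map_pow, hc, smul_pow, eigenvalue_pow_card_eq_one hl0 hc, one_smul]

variable [Finite Γ]

-- `u = l₁ l₂ / (m l₂ ^ m)`, where both `l₁ l₂` and `l₂ ^ m` are invariant.
theorem eigenform_div_mem {l₁ l₂ : K 1} (h₁ : IsEigenform Γ l₁) (h₂ : IsEigenform Γ l₂)
    (h : bracket l₁ l₂ = 1) :
    l₁ / ((Nat.card Γ : K 1) * l₂ ^ (Nat.card Γ - 1)) ∈ KGamma Γ := by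
  have hl₂ : l₂ ≠ 0 := ne_zero_of_bracket_eq_one h
  have hprod : l₁ * l₂ ∈ KGamma Γ := mem_KGamma.2 fun g => by
    obtain ⟨a, ha⟩ := h₁.2 g
    obtain ⟨c, hc⟩ := h₂.2 g
    rw [map_mul, ha, hc, smul_mul_smul_comm, eigenvalue_mul_eigenvalue_eq_one h ha hc, one_smul]
  have hu : l₁ / ((Nat.card Γ : K 1) * l₂ ^ (Nat.card Γ - 1)) =
      l₁ * l₂ / ((Nat.card Γ : K 1) * l₂ ^ Nat.card Γ) := by
    rw [← pow_sub_one_mul Nat.card_pos.ne' l₂, ← mul_assoc, mul_div_mul_right _ _ hl₂]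
  rw [hu]
  exact div_mem hprod (mul_mem (_root_.natCast_mem _ _) (eigenform_pow_card_mem h₂))

-- Over `L = ℂ(u, v)` the form `l₂` generates `K 1` and is a root of `X ^ m - v`, so that
-- `[K 1 : L] ≤ m = |Γ|`.
theorem isCanonicalPair_of_eigenforms {l₁ l₂ : K 1} (h₁ : IsEigenform Γ l₁)
    (h₂ : IsEigenform Γ l₂) (h : bracket l₁ l₂ = 1) :
    IsCanonicalPair Γ (l₁ / ((Nat.card Γ : K 1) * l₂ ^ (Nat.card Γ - 1))) (l₂ ^ Nat.card Γ) := by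
  have hl₂ : l₂ ≠ 0 := ne_zero_of_bracket_eq_one h
  have hm : Nat.card Γ ≠ 0 := Nat.card_pos.ne'
  set u := l₁ / ((Nat.card Γ : K 1) * l₂ ^ (Nat.card Γ - 1)) with hu
  set L := adjoin ℂ {u, l₂ ^ Nat.card Γ}
  have huL : u ∈ L := subset_adjoin _ _ (by simp)
  have hvL : l₂ ^ Nat.card Γ ∈ L := subset_adjoin _ _ (by simp)
  have htop : L⟮l₂⟯ = ⊤ := by
    have hl₂' : l₂ ∈ L⟮l₂⟯.restrictScalars ℂ := mem_adjoin_simple_self L l₂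
    have hl₁' : l₁ ∈ L⟮l₂⟯.restrictScalars ℂ := by
      rw [← div_mul_cancel₀ l₁ (mul_ne_zero (Nat.cast_ne_zero.mpr hm) (pow_ne_zero _ hl₂)), ← hu]
      exact mul_mem (L⟮l₂⟯.algebraMap_mem ⟨u, huL⟩)
        (mul_mem (_root_.natCast_mem _ _) (pow_mem hl₂' _))
    obtain ⟨hx, hy⟩ := x_mem_and_y_mem_of_bracket_eq_one h₁.1 h₂.1 h hl₁' hl₂'
    exact restrictScalars_eq_top_iff.1 (eq_top_of_x_mem_of_y_mem hx hy)
  obtain ⟨_, hfinrank⟩ := finrank_le_of_pow_mem hm hvL htop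
  refine isCanonicalPair_of_adjoin_eq (bracket_div_pow_eq_one h hm) ?_
  refine eq_fixedField_of_finrank_le (adjoin_le_iff.2 (Set.pair_subset ?_ ?_)) ?_
  · exact eigenform_div_mem h₁ h₂ h
  · exact eigenform_pow_card_mem h₂
  · exact hfinrank.trans (Nat.card_congr (Equiv.ofInjective _ gammaAut_injective)).le

end CanonicalPairs

section RationalInvariants

open Polynomial

variable {Γ : Subgroup SL2}

/-! ### Functions of `t = y / x` -/

theorem bracket_eq_zero_of_mem_adjoin_simple {n : ℕ} {t f g : K n} (hf : f ∈ ℂ⟮t⟯)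
    (hg : g ∈ ℂ⟮t⟯) : bracket f g = 0 :=
  bracket_eq_zero_of_mem_adjoin_of_mem_adjoin (by simp [bracket_self]) hf hg

theorem x_ne_zero : (x 0 : K 1) ≠ 0 := by
  intro h
  have hd := partialD_zero_x
  rw [h, map_zero] at hd
  exact zero_ne_one hd

theorem ratio_mul_x : ratio * x 0 = y 0 := div_mul_cancel₀ _ x_ne_zero

theorem x_mul_partialD_one_ratio : x 0 * partialD (0, 1) ratio = 1 := by
  have h := congrArg (partialD (0, 1)) ratio_mul_x
  rwa [Derivation.leibniz, partialD_one_x, partialD_one_y, smul_zero, zero_add, smul_eq_mul] at h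

theorem ratio_notMem_constants : ratio ∉ constants (partialD (0, 1)) := by
  intro h
  have hone := x_mul_partialD_one_ratio
  rw [mem_constants.mp h, mul_zero] at hone
  exact zero_ne_one hone

theorem transcendental_ratio : Transcendental ℂ ratio := fun h =>
  ratio_notMem_constants <| mem_constants_of_isAlgebraic <|
    h.extendScalars (algebraMap ℂ (constants (partialD (0, 1)))).injective

theorem bracket_x (f : K 1) : bracket (x 0) f = partialD (0, 1) f := by
  rw [bracket_skew, x, bracket_coord_zero, neg_neg]

theorem x_mul_partialD_one_mem {f : K 1} (hf : f ∈ ℂ⟮ratio⟯) :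
    x 0 * partialD (0, 1) f ∈ ℂ⟮ratio⟯ := by
  refine derivation_mem_adjoin (D := (x 0 : K 1) • partialD (0, 1)) ?_ hf
  rintro _ rfl
  change x 0 * partialD (0, 1) ratio ∈ _
  rw [x_mul_partialD_one_ratio]
  exact one_mem _

/-- The numerator of the Möbius transformation `t ↦ (g₁₁ t - g₂₁) / (g₂₂ - g₁₂ t)`, which is the
action of `g` on `t = y / x`; the entries of `g : SL2` are indexed from `0`. -/
def moebiusNum (g : SL2) : ℂ[X] := C (g 0 0) * X - C (g 1 0)

/-- The denominator of the Möbius transformation `t ↦ (g₁₁ t - g₂₁) / (g₂₂ - g₁₂ t)`. -/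
def moebiusDenom (g : SL2) : ℂ[X] := C (g 1 1) - C (g 0 1) * X

theorem gammaAut_x_eq (g : Γ) :
    gammaAut Γ g (x 0) = aeval ratio (moebiusDenom g) * x 0 := by
  rw [gammaAut_x, Algebra.smul_def, Algebra.smul_def]
  simp only [moebiusDenom, map_sub, map_mul, aeval_C, aeval_X]
  linear_combination algebraMap ℂ (K 1) ((g : SL2) 0 1) * ratio_mul_x

theorem gammaAut_y_eq (g : Γ) :
    gammaAut Γ g (y 0) = aeval ratio (moebiusNum g) * x 0 := by
  rw [gammaAut_y, Algebra.smul_def, Algebra.smul_def]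
  simp only [moebiusNum, map_sub, map_mul, aeval_C, aeval_X]
  linear_combination -algebraMap ℂ (K 1) ((g : SL2) 0 0) * ratio_mul_x

theorem aeval_moebiusDenom_ne_zero (g : Γ) : aeval ratio (moebiusDenom g) ≠ 0 := by
  intro h
  have hx := gammaAut_x_eq g
  rw [h, zero_mul, map_eq_zero_iff _ (gammaAut Γ g).injective] at hx
  exact x_ne_zero hx

theorem gammaAut_ratio_mul (g : Γ) :
    gammaAut Γ g ratio * aeval ratio (moebiusDenom g) = aeval ratio (moebiusNum g) := by
  have h := congrArg (gammaAut Γ g) ratio_mul_x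
  rw [map_mul, gammaAut_x_eq, gammaAut_y_eq, ← mul_assoc] at h
  exact mul_right_cancel₀ x_ne_zero h

theorem gammaAut_ratio_mem (g : Γ) : gammaAut Γ g ratio ∈ ℂ⟮ratio⟯ := by
  rw [eq_div_of_mul_eq (aeval_moebiusDenom_ne_zero g) (gammaAut_ratio_mul g)]
  exact div_mem (aeval_mem_adjoin_simple _ _) (aeval_mem_adjoin_simple _ _)

theorem coeff_prod_gammaAut_ratio_mem [Fintype Γ] (m : ℕ) :
    (∏ g : Γ, (X - C (gammaAut Γ g ratio))).coeff m ∈ ratioInvariants Γ := by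
  refine ⟨coeff_prod_X_sub_C_mem gammaAut_ratio_mem m, mem_KGamma.2 fun h => ?_⟩
  have hmap : (∏ g : Γ, (X - C (gammaAut Γ g ratio))).map (gammaAut Γ h : K 1 →+* K 1) =
      ∏ g : Γ, (X - C (gammaAut Γ g ratio)) := by
    rw [Polynomial.map_prod]
    refine Fintype.prod_equiv (Equiv.mulLeft h) _ _ fun g => ?_
    simp
  exact (coeff_map (gammaAut Γ h : K 1 →+* K 1) m).symm.trans (congrArg (coeff · m) hmap)

theorem exists_gammaAut_ratio_eq [Finite Γ] {Ω : Type*} [Field Ω] [Algebra ℂ Ω]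
    {σ τ : K 1 →ₐ[ℂ] Ω} (h : Set.EqOn σ τ (ratioInvariants Γ)) :
    ∃ g : Γ, σ ratio = τ (gammaAut Γ g ratio) := by
  have := Fintype.ofFinite Γ
  obtain ⟨g, hg⟩ := exists_map_eq_of_map_prod_X_sub_C_eq (σ : K 1 →+* Ω) τ
    (fun g : Γ => gammaAut Γ g ratio) (Polynomial.ext fun m => by
      rw [coeff_map, coeff_map]
      exact h (coeff_prod_gammaAut_ratio_mem m)) 1
  exact ⟨g, by simpa using hg⟩

/-! ### Pairs from a generator of the invariants -/

theorem partialD_one_ne_zero_of_adjoin_eq [Finite Γ] {v : K 1}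
    (hv : ℂ⟮v⟯ = ratioInvariants Γ) : partialD (0, 1) v ≠ 0 := by
  intro h0
  have := Fintype.ofFinite Γ
  have hle : ratioInvariants Γ ≤ constants (partialD (0, 1)) :=
    hv ▸ adjoin_simple_le_iff.2 (mem_constants.2 h0)
  have halg := isAlgebraic_of_coeff_prod_X_sub_C_mem (s := fun g : Γ => gammaAut Γ g ratio)
    (fun m => hle (coeff_prod_gammaAut_ratio_mem m)) 1
  rw [map_one] at halg
  exact ratio_notMem_constants (mem_constants_of_isAlgebraic halg)

-- `γ x = j x` with `j ∈ ℂ(t)`; as `v ∈ ℂ(t)` too, `γ {x, v} = {j x, v} = j {x, v}`.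
theorem gammaAut_x_mul_partialD_one {v : K 1} (hv : v ∈ ratioInvariants Γ) (g : Γ) :
    gammaAut Γ g (x 0 * partialD (0, 1) v) =
      aeval ratio (moebiusDenom g) ^ 2 * (x 0 * partialD (0, 1) v) := by
  have hj : bracket v (aeval ratio (moebiusDenom g)) = 0 :=
    bracket_eq_zero_of_mem_adjoin_simple hv.1 (aeval_mem_adjoin_simple _ _)
  have hw : gammaAut Γ g (partialD (0, 1) v) =
      aeval ratio (moebiusDenom g) * partialD (0, 1) v := by
    rw [← bracket_x, isPoissonAut_gammaAut g, mem_KGamma.1 hv.2, gammaAut_x_eq, bracket_skew,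
      bracket_mul, hj, bracket_skew v]
    ring
  rw [map_mul, hw, gammaAut_x_eq]
  ring

section Even

variable {v : K 1} (hv : v ∈ ratioInvariants Γ)

include hv

theorem sq_x_div_mem_KGamma : x 0 ^ 2 / (2 * (x 0 * partialD (0, 1) v)) ∈ KGamma Γ := by
  refine mem_KGamma.2 fun g => ?_
  rw [map_div₀, map_mul, gammaAut_x_mul_partialD_one hv, map_pow, gammaAut_x_eq, map_ofNat,
    mul_pow, mul_left_comm]
  exact mul_div_mul_left _ _ (pow_ne_zero 2 (aeval_moebiusDenom_ne_zero g))

-- With `θ = x ∂v/∂y ∈ ℂ(t)` and `x² = 2uθ`, both `{x², v} = 2x {x, v} = 2θ` and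
-- `{x², v} = 2θ {u, v}`.
theorem bracket_sq_x_div_eq_one (h0 : partialD (0, 1) v ≠ 0) :
    bracket (x 0 ^ 2 / (2 * (x 0 * partialD (0, 1) v))) v = 1 := by
  set θ := x 0 * partialD (0, 1) v
  have hθ0 : 2 * θ ≠ 0 := mul_ne_zero two_ne_zero (mul_ne_zero x_ne_zero h0)
  have h2θ : bracket v (2 * θ) = 0 :=
    bracket_eq_zero_of_mem_adjoin_simple hv.1
      (mul_mem (ofNat_mem _ 2) (x_mul_partialD_one_mem hv.1))
  have hsq : bracket v (x 0 ^ 2) = -(2 * θ) := by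
    rw [pow_two, bracket_mul, bracket_skew v, bracket_x]
    ring
  have hmul := bracket_mul v (x 0 ^ 2 / (2 * θ)) (2 * θ)
  rw [div_mul_cancel₀ _ hθ0, hsq, h2θ, mul_zero, zero_add] at hmul
  rw [bracket_skew]
  exact mul_left_cancel₀ hθ0 (by linear_combination hmul)

end Even

theorem exists_gammaAut_eq_of_sq_eq (hΓ : (-1 : SL2) ∈ Γ) {Ω : Type*} [Field Ω] [Algebra ℂ Ω]
    {σ τ : K 1 →ₐ[ℂ] Ω} {g : Γ} (ht : σ ratio = τ (gammaAut Γ g ratio))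
    (hx : σ (x 0) ^ 2 = τ (gammaAut Γ g (x 0)) ^ 2) : ∃ g : Γ, ∀ f, σ f = τ (gammaAut Γ g f) := by
  have hext (g' : Γ) (ht' : σ ratio = τ (gammaAut Γ g' ratio))
      (hx' : σ (x 0) = τ (gammaAut Γ g' (x 0))) : ∀ f, σ f = τ (gammaAut Γ g' f) := by
    refine DFunLike.congr_fun (algHom_ext_xy (τ := τ.comp (gammaAut Γ g').toAlgHom) hx' ?_)
    rw [← ratio_mul_x, map_mul, map_mul, ht', hx']
    rfl
  rcases sq_eq_sq_iff_eq_or_eq_neg.1 hx with hx | hx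
  · exact ⟨g, hext g ht hx⟩
  · have hneg : gammaAut Γ ⟨-1, hΓ⟩ (x 0) = -x 0 ∧ gammaAut Γ ⟨-1, hΓ⟩ (y 0) = -y 0 := by
      simp [gammaAut_x, gammaAut_y]
    have hnegt : gammaAut Γ ⟨-1, hΓ⟩ ratio = ratio := by
      rw [ratio, map_div₀, hneg.1, hneg.2]
      exact neg_div_neg_eq _ _
    refine ⟨g * ⟨-1, hΓ⟩, hext _ ?_ ?_⟩
    · rw [ht, map_mul, AlgEquiv.mul_apply, hnegt]
    · rw [hx, map_mul, AlgEquiv.mul_apply, hneg.1, map_neg, map_neg]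

theorem isCanonicalPair_of_adjoin_eq_ratioInvariants [Finite Γ] {v : K 1} (hΓ : (-1 : SL2) ∈ Γ)
    (hv : ℂ⟮v⟯ = ratioInvariants Γ) :
    IsCanonicalPair Γ (x 0 ^ 2 / (2 * (x 0 * partialD (0, 1) v))) v := by
  have hvmem : v ∈ ratioInvariants Γ := hv ▸ mem_adjoin_simple_self ℂ v
  have h0 := partialD_one_ne_zero_of_adjoin_eq hv
  have hu := sq_x_div_mem_KGamma hvmem
  have huv := bracket_sq_x_div_eq_one hvmem h0
  set θ := x 0 * partialD (0, 1) v
  have hθ0 : 2 * θ ≠ 0 := mul_ne_zero two_ne_zero (mul_ne_zero x_ne_zero h0)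
  set u := x 0 ^ 2 / (2 * θ) with hudef
  have hsq : x 0 ^ 2 = u * (2 * θ) := (div_mul_cancel₀ _ hθ0).symm
  refine isCanonicalPair_of_adjoin_eq huv ?_
  refine adjoin_pair_eq_KGamma_of_forall_algHom huv hu hvmem.2 fun τ hτu hτv => ?_
  have hinv : Set.EqOn τ (Algebra.algHom ℂ (K 1) (AlgebraicClosure (K 1))) (ratioInvariants Γ) :=
    hv ▸ eqOn_adjoin (by rintro _ rfl; exact hτv)
  obtain ⟨g, hg⟩ := exists_gammaAut_ratio_eq hinv
  have hτθ : τ (2 * θ) = algebraMap _ _ (gammaAut Γ g (2 * θ)) :=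
    eqOn_adjoin (S := {ratio})
      (τ := (Algebra.algHom ℂ (K 1) (AlgebraicClosure (K 1))).comp (gammaAut Γ g).toAlgHom)
      (by rintro _ rfl; exact hg)
      (mul_mem (ofNat_mem _ 2) (x_mul_partialD_one_mem hvmem.1))
  refine exists_gammaAut_eq_of_sq_eq hΓ hg ?_
  have hγsq : gammaAut Γ g (x 0 ^ 2) = u * gammaAut Γ g (2 * θ) := by
    rw [hsq, map_mul, mem_KGamma.1 hu]
  rw [← map_pow, ← map_pow, ← map_pow, hγsq, hsq, map_mul τ u, map_mul _ u, hτθ, hτu]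
  rfl

theorem ExplicitPair.isCanonicalPair [Finite Γ] {u v : K 1} (h : ExplicitPair Γ u v) :
    IsCanonicalPair Γ u v := by
  cases h with
  | cyclic l₁ l₂ h₁ h₂ h => exact isCanonicalPair_of_eigenforms h₁ h₂ h
  | even v hΓ hv => exact isCanonicalPair_of_adjoin_eq_ratioInvariants hΓ hv

/-! ### Generators of `ℂ(t) ∩ K_1^Γ` -/

theorem exists_orbit_representatives (Γ : Subgroup SL2) [Finite Γ] : ∃ R : Finset Γ, 1 ∈ R ∧
    Set.BijOn (fun g => gammaAut Γ g ratio) R (Set.range fun g : Γ => gammaAut Γ g ratio) := by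
  have hone : Set.BijOn (fun g : Γ => gammaAut Γ g ratio) {1} {ratio} := by simp
  obtain ⟨R, h1R, hR⟩ := hone.exists_extend
    (Set.singleton_subset_iff.2 (Set.mem_range.2 ⟨1, by simp⟩)) subset_rfl
  exact ⟨R.toFinite.toFinset, by simpa using h1R, by simpa using hR⟩

theorem orbitProduct_eq_prod {R : Finset Γ}
    (hR : Set.BijOn (fun g => gammaAut Γ g ratio) R (Set.range fun g : Γ => gammaAut Γ g ratio))
    (a : ℂ) : orbitProduct Γ a = ∏ g ∈ R, (gammaAut Γ g ratio - algebraMap ℂ (K 1) a) := by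
  rw [← finprod_mem_coe_finset]
  exact (finprod_mem_eq_of_bijOn _ hR fun _ _ => rfl).symm

theorem orbitProduct_mem [Finite Γ] (a : ℂ) : orbitProduct Γ a ∈ ratioInvariants Γ := by
  constructor
  · obtain ⟨R, -, hR⟩ := exists_orbit_representatives Γ
    rw [orbitProduct_eq_prod hR]
    exact prod_mem fun g _ => sub_mem (gammaAut_ratio_mem g) (ℂ⟮ratio⟯.algebraMap_mem a)
  · refine mem_KGamma.2 fun h => ?_
    have hbij : Set.BijOn (gammaAut Γ h) (Set.range fun g : Γ => gammaAut Γ g ratio)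
        (Set.range fun g : Γ => gammaAut Γ g ratio) := by
      refine ⟨?_, (gammaAut Γ h).injective.injOn, ?_⟩
      · rintro _ ⟨g, rfl⟩
        exact ⟨h * g, by simp⟩
      · rintro _ ⟨g, rfl⟩
        exact ⟨_, ⟨h⁻¹ * g, rfl⟩, by simp [← AlgEquiv.mul_apply, ← map_mul]⟩
    refine (MonoidHom.map_finprod_mem _ (gammaAut Γ h : K 1 →* K 1) (Set.finite_range _)).trans ?_
    exact finprod_mem_eq_of_bijOn _ hbij fun s _ => by simp

theorem isIntegral_ratio [Finite Γ] : IsIntegral (ratioInvariants Γ) ratio := by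
  have := Fintype.ofFinite Γ
  have halg := isAlgebraic_of_coeff_prod_X_sub_C_mem (s := fun g : Γ => gammaAut Γ g ratio)
    coeff_prod_gammaAut_ratio_mem 1
  rw [map_one] at halg
  exact halg.isIntegral

section OrbitProduct

variable {a : ℂ} {R : Finset Γ}

theorem orbitProduct_ne_zero [Finite Γ] : orbitProduct Γ a ≠ 0 := by
  obtain ⟨R, -, hR⟩ := exists_orbit_representatives Γ
  rw [orbitProduct_eq_prod hR, Finset.prod_ne_zero_iff]
  intro g _ h0
  rw [sub_eq_zero, ← (gammaAut Γ g).commutes a] at h0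
  exact transcendental_ratio ((gammaAut Γ g).injective h0 ▸ isAlgebraic_algebraMap a)

theorem natDegree_moebiusDenom_le (g : SL2) : (moebiusDenom g).natDegree ≤ 1 := by
  rw [moebiusDenom]
  compute_degree

theorem natDegree_moebiusNum_sub_le (g : SL2) :
    (moebiusNum g - C a * moebiusDenom g).natDegree ≤ 1 := by
  rw [moebiusNum, moebiusDenom]
  compute_degree

theorem eval_moebiusDenom (g : SL2) : (moebiusDenom g).eval a = g 1 1 - g 0 1 * a := by
  rw [moebiusDenom, eval_sub, eval_C_mul, eval_C, eval_X]

theorem eval_moebiusNum_one_sub : (moebiusNum 1 - C a * moebiusDenom 1).eval a = 0 := by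
  have h00 : (1 : SL2) 0 0 = 1 := rfl
  have h10 : (1 : SL2) 1 0 = 0 := rfl
  have h01 : (1 : SL2) 0 1 = 0 := rfl
  have h11 : (1 : SL2) 1 1 = 1 := rfl
  rw [eval_sub, eval_C_mul, eval_moebiusDenom, moebiusNum, eval_sub, eval_C_mul, eval_X, eval_C,
    h00, h10, h01, h11]
  ring

theorem prod_gammaAut_ratio_sub_mul :
    (∏ g ∈ R, (gammaAut Γ g ratio - algebraMap ℂ (K 1) a)) *
        aeval ratio (∏ g ∈ R, moebiusDenom (g : SL2)) =
      aeval ratio (∏ g ∈ R, (moebiusNum (g : SL2) - C a * moebiusDenom (g : SL2))) := by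
  rw [map_prod, map_prod, ← Finset.prod_mul_distrib]
  refine Finset.prod_congr rfl fun g _ => ?_
  rw [map_sub, map_mul, ← gammaAut_ratio_mul, aeval_C, sub_mul]

theorem eval_prod_moebiusNum_sub (h1R : 1 ∈ R) :
    (∏ g ∈ R, (moebiusNum (g : SL2) - C a * moebiusDenom (g : SL2))).eval a = 0 := by
  rw [eval_prod]
  exact Finset.prod_eq_zero h1R eval_moebiusNum_one_sub

theorem eval_prod_moebiusDenom_ne_zero (ha : ∀ g ∈ Γ, g.1 1 1 ≠ a * g.1 0 1) :
    (∏ g ∈ R, moebiusDenom (g : SL2)).eval a ≠ 0 := by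
  rw [eval_prod, Finset.prod_ne_zero_iff]
  intro g _
  rw [eval_moebiusDenom, mul_comm]
  exact sub_ne_zero.2 (ha g g.2)

end OrbitProduct

-- `v` is a quotient of polynomials in `t` of degree at most the size of the orbit, which in turn
-- is at most the degree of `t` over the invariants.
theorem adjoin_orbitProduct (Γ : Subgroup SL2) [Finite Γ] (a : ℂ)
    (ha : ∀ g ∈ Γ, g.1 1 1 ≠ a * g.1 0 1) : ℂ⟮orbitProduct Γ a⟯ = ratioInvariants Γ := by
  obtain ⟨R, h1R, hR⟩ := exists_orbit_representatives Γ
  have hquot := prod_gammaAut_ratio_sub_mul (a := a) (R := R)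
  rw [← orbitProduct_eq_prod hR] at hquot
  have hnum : (∏ g ∈ R, (moebiusNum (g : SL2) - C a * moebiusDenom (g : SL2))).natDegree ≤
      R.card := natDegree_prod_le_card fun g => natDegree_moebiusNum_sub_le g.1
  have hdenom : (∏ g ∈ R, moebiusDenom (g : SL2)).natDegree ≤ R.card :=
    natDegree_prod_le_card fun g => natDegree_moebiusDenom_le g.1
  obtain ⟨hint, hdeg⟩ := minpoly_adjoin_simple_natDegree_le hnum hdenom hquot orbitProduct_ne_zero
    (eval_prod_moebiusNum_sub h1R) (eval_prod_moebiusDenom_ne_zero ha)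
  have hcard : R.card ≤ (minpoly (ratioInvariants Γ) ratio).natDegree :=
    card_le_natDegree_minpoly isIntegral_ratio (s := fun g => (gammaAut Γ g).toAlgHom)
      (fun g f hf => mem_KGamma.1 hf.2 g) hR.injOn
  exact eq_of_natDegree_minpoly_le (adjoin_simple_le_iff.2 (orbitProduct_mem a)) inf_le_left hint
    (hdeg.trans hcard)

/-! ### Existence of explicit pairs -/

theorem exists_forall_ne_mul (Γ : Subgroup SL2) [Finite Γ] :
    ∃ a : ℂ, ∀ g ∈ Γ, g.1 1 1 ≠ a * g.1 0 1 := by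
  obtain ⟨a, ha⟩ := (Set.finite_range fun g : Γ => (g : SL2) 1 1 / (g : SL2) 0 1).exists_notMem
  refine ⟨a, fun g hg h => ?_⟩
  by_cases h0 : g 0 1 = 0
  · have hdet := Matrix.SpecialLinearGroup.det_coe g
    rw [Matrix.det_fin_two, h, h0] at hdet
    simp at hdet
  · exact ha ⟨⟨g, hg⟩, (eq_div_of_mul_eq h0 h.symm).symm⟩

open Matrix in
theorem isEigenform_of_eigenvector {w : Fin 2 → ℂ}
    (hw : ∀ g : Γ, ∃ c : ℂ, g.1.1 *ᵥ w = c • w) : IsEigenform Γ (-w 1 • x 0 + w 0 • y 0) := by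
  refine ⟨⟨_, _, rfl⟩, fun g => ?_⟩
  obtain ⟨c, hc⟩ := hw g
  have h0 : (g : SL2) 0 0 * w 0 + (g : SL2) 0 1 * w 1 = c * w 0 := by
    simpa [mulVec, dotProduct] using congrFun hc 0
  have h1 : (g : SL2) 1 0 * w 0 + (g : SL2) 1 1 * w 1 = c * w 1 := by
    simpa [mulVec, dotProduct] using congrFun hc 1
  refine ⟨c, ?_⟩
  calc gammaAut Γ g (-w 1 • x 0 + w 0 • y 0)
      = -((g : SL2) 1 0 * w 0 + (g : SL2) 1 1 * w 1) • x 0 +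
          ((g : SL2) 0 0 * w 0 + (g : SL2) 0 1 * w 1) • y 0 := by
        simp only [Algebra.smul_def, map_add, map_mul, AlgEquiv.commutes, gammaAut_x, gammaAut_y,
          map_neg]
        ring
    _ = c • (-w 1 • x 0 + w 0 • y 0) := by
        rw [h0, h1]
        module

theorem exists_explicitPair (Γ : Subgroup SL2) [Finite Γ] : ∃ u v, ExplicitPair Γ u v := by
  by_cases h : (-1 : SL2) ∈ Γ
  · obtain ⟨a, ha⟩ := exists_forall_ne_mul Γ
    exact ⟨_, _, .even _ h (adjoin_orbitProduct Γ a ha)⟩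
  · obtain ⟨w, z, hw, hz, hwz⟩ := exists_eigenvectors (odd_card_of_neg_one_notMem h)
    refine ⟨_, _, .cyclic _ _ (isEigenform_of_eigenvector hw) (isEigenform_of_eigenvector hz) ?_⟩
    rw [bracket_linearForm, ← map_one (algebraMap ℂ (K 1)), ← hwz]
    congr 1
    ring

end RationalInvariants

section Factors

variable {n : ℕ}

/-! ### The factors of `K n` -/

theorem factor_coord (i : Fin n) (k : Fin 1) (b : Fin 2) :
    factor i (coord (k, b)) = coord (i, b) := by
  rw [factor, coord, IsFractionRing.liftAlgHom_apply, IsFractionRing.lift_algebraMap]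
  exact congrArg (algebraMap (P n) (K n)) (MvPolynomial.rename_X _ _)

theorem bracket_factor_of_ne {i j : Fin n} (hij : i ≠ j) (f g : K 1) :
    bracket (factor i f) (factor j g) = 0 := by
  have hcoord (p q : Fin 1 × Fin 2) : bracket (factor i (coord p)) (factor j (coord q)) = 0 := by
    obtain ⟨l, c⟩ := q
    rw [factor_coord, factor_coord]
    fin_cases c <;> simp [bracket_coord_zero, bracket_coord_one, partialD_coord, hij]
  simp only [bracket_map_map_eq_sum, hcoord, mul_zero, Finset.sum_const_zero]

theorem bracket_factor_self (i : Fin n) (f g : K 1) :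
    bracket (factor i f) (factor i g) = factor i (bracket f g) := by
  refine (map_bracket_of_coord _ ?_ f g).symm
  rintro ⟨k, b⟩ ⟨l, c⟩
  obtain rfl := Subsingleton.elim k l
  rw [factor_coord, factor_coord]
  fin_cases b <;> fin_cases c <;> simp [bracket_coord_zero, bracket_coord_one, partialD_coord]

theorem bracket_factor_factor_same (f : K 1) (i j : Fin n) :
    bracket (factor i f) (factor j f) = 0 := by
  rcases eq_or_ne i j with rfl | hij
  · rw [bracket_factor_self, bracket_self, map_zero]
  · exact bracket_factor_of_ne hij f f

theorem wreathAut_factor {Γ : Subgroup SL2} (g : Wreath Γ n) (i : Fin n) (f : K 1) :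
    wreathAut Γ n g (factor i f) = factor (g.right i) (gammaAut Γ (g⁻¹.left i)⁻¹ f) := by
  have hcomp : (wreathAut Γ n g).toAlgHom.comp (factor i) =
      (factor (g.right i)).comp (gammaAut Γ (g⁻¹.left i)⁻¹).toAlgHom := by
    refine algHom_ext_coord ?_
    rintro ⟨k, b⟩
    obtain rfl := Subsingleton.elim k 0
    change wreathAut Γ n g (factor i (coord (0, b))) =
      factor (g.right i) (gammaAut Γ (g⁻¹.left i)⁻¹ (coord (0, b)))
    simp only [factor_coord, wreathAut_coord_eq_sum, gammaAut_coord, map_sum, Subgroup.coe_inv,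
      inv_inv]
    refine Finset.sum_congr rfl fun c _ => ?_
    rw [Algebra.smul_def, Algebra.smul_def, map_mul, AlgHom.commutes, factor_coord]
  exact DFunLike.congr_fun hcomp f

theorem wreathAut_factor_of_mem {Γ : Subgroup SL2} {f : K 1} (hf : f ∈ KGamma Γ) (g : Wreath Γ n)
    (i : Fin n) : wreathAut Γ n g (factor i f) = factor (g.right i) f := by
  rw [wreathAut_factor, mem_KGamma.1 hf]

/-! ### Permutations of the factors -/

section Perm

variable {u v : K 1} {π : Equiv.Perm (Fin n)}

section CommRing

variable {B : Type*} [CommRing B] [Algebra ℂ B] {φ ψ : K n →ₐ[ℂ] B}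
  (hv : ∀ i, φ (factor i v) = ψ (factor (π i) v))

include hv

theorem map_bigV (k : Fin n) : φ (bigV n v k) = ψ (bigV n v k) := by
  have hsymm : MvPolynomial.rename π (elem n k) = elem n k := MvPolynomial.rename_esymm _ _ _ π
  rw [bigV, MvPolynomial.comp_aeval_apply, MvPolynomial.comp_aeval_apply]
  conv_rhs => rw [← hsymm, MvPolynomial.aeval_rename]
  exact congrArg (MvPolynomial.aeval · _) (funext hv)

theorem map_jacobian (i k : Fin n) : φ (jacobian n v i k) = ψ (jacobian n v (π i) k) := by
  have hsymm : MvPolynomial.rename π (elem n k) = elem n k := MvPolynomial.rename_esymm _ _ _ π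
  rw [jacobian, Matrix.of_apply, Matrix.of_apply, MvPolynomial.comp_aeval_apply,
    MvPolynomial.comp_aeval_apply]
  conv_rhs => rw [← hsymm, MvPolynomial.pderiv_rename π.injective, MvPolynomial.aeval_rename]
  exact congrArg (MvPolynomial.aeval · _) (funext hv)

end CommRing

-- Permuting the rows of `M` permutes the columns of `M⁻¹`.
theorem map_bigU {B : Type*} [Field B] [Algebra ℂ B] {φ ψ : K n →ₐ[ℂ] B}
    (hu : ∀ i, φ (factor i u) = ψ (factor (π i) u))
    (hv : ∀ i, φ (factor i v) = ψ (factor (π i) v)) (k : Fin n) :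
    φ (bigU n u v k) = ψ (bigU n u v k) := by
  have hM : (jacobian n v).map φ = ((jacobian n v).map ψ).submatrix π (Equiv.refl _) :=
    Matrix.ext fun i l => map_jacobian hv i l
  have hinv (i : Fin n) : φ ((jacobian n v)⁻¹ k i) = ψ ((jacobian n v)⁻¹ k (π i)) := by
    have hφ := map_inv_apply (φ : K n →+* B) (jacobian n v) k i
    have hψ := map_inv_apply (ψ : K n →+* B) (jacobian n v) k (π i)
    simp only [RingHom.coe_coe] at hφ hψ
    rw [hφ, hψ, hM, Matrix.inv_submatrix_equiv]
    rfl
  simp only [bigU, map_sum, map_mul, hu, hinv]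
  exact Equiv.sum_comp π fun i => ψ ((jacobian n v)⁻¹ k i) * ψ (factor i u)

end Perm

/-! ### Symmetric functions of the copies of `v` -/

open Polynomial in
theorem coeff_prod_X_sub_C_factor_mem (v : K 1) (m : ℕ) :
    (∏ i : Fin n, (X - C (factor i v))).coeff m ∈ adjoin ℂ (Set.range (bigV n v)) :=
  coeff_prod_X_sub_C_mem_of_esymm_mem (fun j =>
    subset_adjoin ℂ _ (Set.mem_range_self (f := bigV n v) j)) m

theorem derivation_factor_eq_zero {v : K 1} {D : Derivation ℂ (K n) (K n)}
    (hD : ∀ j, D (bigV n v j) = 0) (i : Fin n) : D (factor i v) = 0 := by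
  have hle : adjoin ℂ (Set.range (bigV n v)) ≤ constants D :=
    adjoin_le_iff.2 (Set.range_subset_iff.2 fun j => mem_constants.2 (hD j))
  exact mem_constants.1 <| mem_constants_of_isAlgebraic <|
    isAlgebraic_of_coeff_prod_X_sub_C_mem (fun m => hle (coeff_prod_X_sub_C_factor_mem v m)) i

section Pair

variable {u v : K 1} (h : bracket u v = 1)

include h

theorem bracket_factor_factor (i j : Fin n) :
    bracket (factor i u) (factor j v) = if i = j then 1 else 0 := by
  split_ifs with hij
  · rw [hij, bracket_factor_self, h, map_one]
  · exact bracket_factor_of_ne hij u v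

theorem factor_apply_injective : Function.Injective fun i : Fin n => factor i v := by
  intro i j hij
  have hi := bracket_factor_factor h i i
  have hj := bracket_factor_factor h i j
  rw [← show factor i v = factor j v from hij, hi] at hj
  simpa using hj

theorem bracket_factor_bigV (i j : Fin n) :
    bracket (factor i u) (bigV n v j) = jacobian n v i j := by
  rw [bigV, ← ham_apply, derivation_aeval_eq_sum]
  simp [ham_apply, bracket_factor_factor h, jacobian]

-- A left kernel vector `c` of the Jacobian gives the derivation `∑ cₖ {uₖ, ·}`, which kills every
-- `Vⱼ`, hence every `vᵢ`; but it maps `vᵢ` to `cᵢ`.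
theorem det_jacobian_ne_zero : (jacobian n v).det ≠ 0 := by
  intro hdet
  obtain ⟨c, hc0, hc⟩ := Matrix.exists_vecMul_eq_zero_iff.mpr hdet
  let D : Derivation ℂ (K n) (K n) := ∑ k, c k • ham (factor k u)
  have hD (f : K n) : D f = ∑ k, c k * bracket (factor k u) f := by
    simp only [D, ← ham_apply]
    rw [← Derivation.coeFnAddMonoidHom_apply, map_sum, Finset.sum_apply]
    rfl
  have hV (j : Fin n) : D (bigV n v j) = 0 := by
    simp only [hD, bracket_factor_bigV h]
    exact congrFun hc j
  refine hc0 (funext fun i => ?_)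
  have hi := derivation_factor_eq_zero hV i
  simpa [hD, bracket_factor_factor h] using hi

theorem factor_eq_sum (i : Fin n) : factor i u = ∑ k, jacobian n v i k * bigU n u v k := by
  have hmul : (jacobian n v).mulVec (bigU n u v) = fun i => factor i u := by
    change (jacobian n v).mulVec ((jacobian n v)⁻¹.mulVec fun i => factor i u) = _
    rw [Matrix.mulVec_mulVec, Matrix.mul_nonsing_inv _ (det_jacobian_ne_zero h).isUnit,
      Matrix.one_mulVec]
  exact (congrFun hmul i).symm

end Pair

/-! ### Brackets of the `U` and `V` -/

/-- The field `ℂ(v₁, …, vₙ)` generated by the copies of `v`; it Poisson commutes with itself. -/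
def vField (n : ℕ) (v : K 1) : IntermediateField ℂ (K n) :=
  adjoin ℂ (Set.range fun i : Fin n => factor i v)

theorem bracket_eq_zero_of_mem_vField {v : K 1} {f g : K n} (hf : f ∈ vField n v)
    (hg : g ∈ vField n v) : bracket f g = 0 :=
  bracket_eq_zero_of_mem_adjoin_of_mem_adjoin
    (by rintro _ ⟨i, rfl⟩ _ ⟨j, rfl⟩; exact bracket_factor_factor_same v i j) hf hg

theorem factor_mem_vField (v : K 1) (i : Fin n) : factor i v ∈ vField n v :=
  subset_adjoin ℂ _ ⟨i, rfl⟩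

theorem aeval_factor_mem_vField (v : K 1) (q : MvPolynomial (Fin n) ℂ) :
    MvPolynomial.aeval (fun i => factor i v) q ∈ vField n v := by
  refine algebra_adjoin_le_adjoin ℂ _ ?_
  rw [Algebra.adjoin_range_eq_range_aeval]
  exact ⟨q, rfl⟩

theorem jacobian_inv_mem_vField (v : K 1) (i j : Fin n) : (jacobian n v)⁻¹ i j ∈ vField n v :=
  inv_apply_mem _ (fun _ _ => aeval_factor_mem_vField v _) i j

theorem bigV_mem_vField (v : K 1) (i : Fin n) : bigV n v i ∈ vField n v :=
  aeval_factor_mem_vField v _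

theorem bracket_bigV_bigV (v : K 1) (i j : Fin n) : bracket (bigV n v i) (bigV n v j) = 0 :=
  bracket_eq_zero_of_mem_vField (bigV_mem_vField v i) (bigV_mem_vField v j)

/-- The combinations of the copies of `u` with coefficients in `ℂ(v₁, …, vₙ)`. For a pair with
`{u, v} = 1` they are closed under the bracket, and each of them acts on `ℂ(v₁, …, vₙ)` as a vector
field, which determines it. -/
def linearMomenta (n : ℕ) (u v : K 1) : Submodule (vField n v) (K n) :=
  Submodule.span (vField n v) (Set.range fun i : Fin n => factor i u)

theorem bigU_mem_linearMomenta (u v : K 1) (i : Fin n) : bigU n u v i ∈ linearMomenta n u v :=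
  sum_mem fun l _ => Submodule.smul_mem _ (⟨_, jacobian_inv_mem_vField v i l⟩ : vField n v)
    (Submodule.subset_span ⟨l, rfl⟩)

theorem sum_mul_bracket_of_mem_vField {v : K 1} {ι : Type*} {s : Finset ι} {c : ι → K n}
    (f : ι → K n) {g : K n} (hc : ∀ i, c i ∈ vField n v) (hg : g ∈ vField n v) :
    bracket (∑ i ∈ s, c i * f i) g = ∑ i ∈ s, c i * bracket (f i) g := by
  rw [bracket_skew, ← ham_apply, map_sum, ← Finset.sum_neg_distrib]
  refine Finset.sum_congr rfl fun i _ => ?_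
  rw [ham_apply, ← bracket_skew, mul_bracket, bracket_eq_zero_of_mem_vField (hc i) hg, mul_zero,
    add_zero]

section Momenta

variable {u v : K 1} (h : bracket u v = 1)

include h

theorem eq_zero_of_mem_linearMomenta {f : K n} (hf : f ∈ linearMomenta n u v)
    (hfv : ∀ k, bracket f (factor k v) = 0) : f = 0 := by
  obtain ⟨c, rfl⟩ := (Submodule.mem_span_range_iff_exists_fun _).1 hf
  refine Finset.sum_eq_zero fun k _ => ?_
  have hk := hfv k
  simp only [smul_def, smul_eq_mul, sum_mul_bracket_of_mem_vField _ (fun i => (c i).2)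
    (factor_mem_vField v k), bracket_factor_factor h] at hk
  simp_all

theorem bracket_mem_vField_of_mem_linearMomenta {f g : K n} (hf : f ∈ linearMomenta n u v)
    (hg : g ∈ vField n v) : bracket f g ∈ vField n v := by
  have hgen (l : Fin n) : bracket (factor l u) g ∈ vField n v := by
    rw [← ham_apply]
    refine derivation_mem_adjoin ?_ hg
    rintro _ ⟨j, rfl⟩
    rw [ham_apply, bracket_factor_factor h]
    split_ifs
    exacts [one_mem _, zero_mem _]
  obtain ⟨c, rfl⟩ := (Submodule.mem_span_range_iff_exists_fun _).1 hf
  simp only [smul_def, smul_eq_mul, sum_mul_bracket_of_mem_vField _ (fun i => (c i).2) hg]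
  exact sum_mem fun l _ => mul_mem (c l).2 (hgen l)

theorem bracket_mem_linearMomenta_of_forall {f g : K n} (hf : f ∈ linearMomenta n u v)
    (hfu : ∀ l, bracket f (factor l u) ∈ linearMomenta n u v) (hg : g ∈ linearMomenta n u v) :
    bracket f g ∈ linearMomenta n u v := by
  induction hg using Submodule.span_induction with
  | mem g hg =>
    obtain ⟨l, rfl⟩ := hg
    exact hfu l
  | zero => rw [← ham_apply, map_zero]; exact zero_mem _
  | add g₁ g₂ _ _ ih₁ ih₂ =>
    rw [← ham_apply, map_add, ham_apply, ham_apply]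
    exact add_mem ih₁ ih₂
  | smul c g hg ih =>
    have hfc := bracket_mem_vField_of_mem_linearMomenta h hf c.2
    rw [smul_def, smul_eq_mul, bracket_mul, mul_comm g]
    exact add_mem (Submodule.smul_mem _ c ih) (Submodule.smul_mem _ ⟨_, hfc⟩ hg)

theorem bracket_mem_linearMomenta {f g : K n} (hf : f ∈ linearMomenta n u v)
    (hg : g ∈ linearMomenta n u v) : bracket f g ∈ linearMomenta n u v := by
  have hu (l : Fin n) : factor l u ∈ linearMomenta n u v := Submodule.subset_span ⟨l, rfl⟩
  refine bracket_mem_linearMomenta_of_forall h hf (fun l => ?_) hg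
  rw [bracket_skew]
  refine neg_mem (bracket_mem_linearMomenta_of_forall h (hu l) (fun k => ?_) hf)
  rw [bracket_factor_factor_same]
  exact zero_mem _

theorem bracket_bigU_bigV (i j : Fin n) :
    bracket (bigU n u v i) (bigV n v j) = if i = j then 1 else 0 := by
  have hinv := Matrix.nonsing_inv_mul (jacobian n v) (det_jacobian_ne_zero h).isUnit
  have hij := congrFun (congrFun hinv i) j
  rw [Matrix.mul_apply, Matrix.one_apply] at hij
  rw [bigU, sum_mul_bracket_of_mem_vField _ (jacobian_inv_mem_vField v i) (bigV_mem_vField v j),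
    ← hij]
  simp only [bracket_factor_bigV h]

theorem bracket_bigU_bigU (i j : Fin n) : bracket (bigU n u v i) (bigU n u v j) = 0 := by
  have hmem := bracket_mem_linearMomenta h (bigU_mem_linearMomenta u v i)
    (bigU_mem_linearMomenta u v j)
  refine eq_zero_of_mem_linearMomenta h hmem fun k => ?_
  rw [← ham_apply]
  refine derivation_factor_eq_zero (fun l => ?_) k
  rw [ham_apply, bracket_bracket, bracket_bigU_bigV h, bracket_bigU_bigV h, ← ham_apply,
    ← ham_apply]
  split_ifs <;> simp

theorem isCanonical_bigU_bigV :
    IsCanonical fun p : Fin n × Fin 2 => (![bigU n u v p.1, bigV n v p.1] : Fin 2 → K n) p.2 := by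
  rintro ⟨i, b⟩ ⟨j, c⟩
  fin_cases b <;> fin_cases c
  · simp [bracket_bigU_bigU h, bracket_coord_zero, partialD_coord]
  · simp [bracket_bigU_bigV h, bracket_coord_one, partialD_coord]
  · simp [bracket_skew (bigV n v i), bracket_bigU_bigV h, bracket_coord_zero, partialD_coord,
      eq_comm]
  · simp [bracket_bigV_bigV, bracket_coord_one, partialD_coord]

end Momenta

/-! ### Invariants of the wreath product -/

theorem exists_perm_of_map_bigV {u v : K 1} (h : bracket u v = 1) {Ω : Type*} [Field Ω]
    [Algebra ℂ Ω] {φ ψ : K n →ₐ[ℂ] Ω} (hV : ∀ i, φ (bigV n v i) = ψ (bigV n v i)) :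
    ∃ π : Equiv.Perm (Fin n), ∀ i, φ (factor i v) = ψ (factor (π i) v) := by
  have hroots := exists_map_eq_of_map_prod_X_sub_C_eq (φ : K n →+* Ω) (ψ : K n →+* Ω)
    (fun i : Fin n => factor i v) (Polynomial.ext fun m => by
      rw [Polynomial.coeff_map, Polynomial.coeff_map]
      exact eqOn_adjoin (Set.forall_mem_range.2 hV) (coeff_prod_X_sub_C_factor_mem v m))
  choose π hπ using hroots
  have hinj : Function.Injective π := fun i j hij =>
    factor_apply_injective h ((φ : K n →+* Ω).injective (by rw [hπ i, hπ j, hij]))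
  exact ⟨.ofBijective π hinj.bijective_of_finite, hπ⟩

end Factors

section WreathInvariants

variable {Γ : Subgroup SL2} {n : ℕ} {u v : K 1} (h : IsCanonicalPair Γ u v)

include h

theorem bigU_mem_and_bigV_mem (i : Fin n) :
    bigU n u v i ∈ KWreath Γ n ∧ bigV n v i ∈ KWreath Γ n := by
  obtain ⟨hu, hv⟩ := h.mem
  constructor <;> refine mem_fixedField_iff _ _ |>.2 ?_ <;> rintro _ ⟨g, rfl⟩
  · exact map_bigU (φ := (wreathAut Γ n g).toAlgHom) (ψ := AlgHom.id ℂ (K n))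
      (wreathAut_factor_of_mem hu g) (wreathAut_factor_of_mem hv g) i
  · exact map_bigV (φ := (wreathAut Γ n g).toAlgHom) (ψ := AlgHom.id ℂ (K n))
      (wreathAut_factor_of_mem hv g) i

variable [Finite Γ]

theorem exists_wreathAut_of_map_eq {Ω : Type*} [Field Ω] [Algebra ℂ Ω] {φ ψ : K n →ₐ[ℂ] Ω}
    (hU : ∀ i, φ (bigU n u v i) = ψ (bigU n u v i))
    (hV : ∀ i, φ (bigV n v i) = ψ (bigV n v i)) : ∃ g, ∀ f, φ f = ψ (wreathAut Γ n g f) := by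
  obtain ⟨π, hv⟩ := exists_perm_of_map_bigV h.bracket_eq_one hV
  have hu (i : Fin n) : φ (factor i u) = ψ (factor (π i) u) := by
    rw [factor_eq_sum h.bracket_eq_one, factor_eq_sum h.bracket_eq_one, map_sum, map_sum]
    simp only [map_mul, hU, map_jacobian hv]
  have hfactor (i : Fin n) :
      ∃ g : Γ, ∀ f, φ (factor i f) = ψ (factor (π i) (gammaAut Γ g f)) := by
    have : Finite (gammaAut Γ).range := Finite.of_surjective _ (gammaAut Γ).rangeRestrict_surjective
    obtain ⟨_, ⟨g, rfl⟩, hg⟩ := exists_eq_comp_of_eqOn_fixedField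
      (h.eqOn_KGamma (σ := φ.comp (factor i)) (τ := ψ.comp (factor (π i))) (hu i) (hv i))
    exact ⟨g, hg⟩
  choose γ hγ using hfactor
  let g : Wreath Γ n := ⟨fun k => γ (π.symm k), π⟩
  have hg (i : Fin n) : (g⁻¹.left i)⁻¹ = γ i := by
    change (γ (π.symm (π i)))⁻¹⁻¹ = γ i
    rw [inv_inv, π.symm_apply_apply]
  refine ⟨g, DFunLike.congr_fun (algHom_ext_coord (τ := ψ.comp (wreathAut Γ n g).toAlgHom) ?_)⟩
  rintro ⟨i, b⟩
  change _ = ψ (wreathAut Γ n g (coord (i, b)))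
  rw [← factor_coord i 0 b, wreathAut_factor, hg, hγ]

theorem exists_poissonEquiv_KWreath : ∃ e : PoissonEquiv ℂ (KWreath Γ n) (K n), ∀ i : Fin n,
    ((e.toAlgEquiv.symm (x i) : KWreath Γ n) : K n) = bigU n u v i ∧
    ((e.toAlgEquiv.symm (y i) : KWreath Γ n) : K n) = bigV n v i := by
  have hcan := isCanonical_bigU_bigV (n := n) h.bracket_eq_one
  have hadj := hcan.adjoin_eq_fixedField (H := (wreathAut Γ n).range)
    (by
      rintro ⟨i, b⟩
      obtain ⟨hU, hV⟩ := bigU_mem_and_bigV_mem h i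
      fin_cases b
      exacts [hU, hV])
    (fun τ hτ => by
      obtain ⟨g, hg⟩ := exists_wreathAut_of_map_eq h (φ := τ)
        (ψ := Algebra.algHom ℂ (K n) (AlgebraicClosure (K n)))
        (fun i => hτ (i, 0)) (fun i => hτ (i, 1))
      exact ⟨_, ⟨g, rfl⟩, hg⟩)
  obtain ⟨e, he⟩ := hcan.exists_poissonEquiv
    (by rintro _ ⟨g, rfl⟩; exact wreathAut_isPoissonAut Γ n g) hadj
  exact ⟨e, fun i => ⟨he (i, 0), he (i, 1)⟩⟩

end WreathInvariants

end PoissonNoether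

end

open PoissonNoether in
theorem mainTheorem3 (Γ : Subgroup SL2) [Finite Γ] (n : ℕ) :
    (∀ a : ℂ, (∀ g ∈ Γ, g.1 1 1 ≠ a * g.1 0 1) →
      IntermediateField.adjoin ℂ {orbitProduct Γ a} = ratioInvariants Γ) ∧
    (∃ u v : K 1, ExplicitPair Γ u v) ∧
    (∀ u v : K 1, ExplicitPair Γ u v → IsCanonicalPair Γ u v) ∧
    ∀ u v : K 1, IsCanonicalPair Γ u v →
      (jacobian n v).det ≠ 0 ∧
      ∃ e : PoissonEquiv ℂ (KWreath Γ n) (K n), ∀ i : Fin n,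
        ((e.toAlgEquiv.symm (x i) : KWreath Γ n) : K n) = bigU n u v i ∧
        ((e.toAlgEquiv.symm (y i) : KWreath Γ n) : K n) = bigV n v i := by
  refine ⟨adjoin_orbitProduct Γ, exists_explicitPair Γ, fun _ _ h => h.isCanonicalPair,
    fun _ _ h => ⟨?_, exists_poissonEquiv_KWreath h⟩⟩
  exact det_jacobian_ne_zero h.bracket_eq_one
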